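/- **Setting.** Fix integers $N\ge 2$ and $d\ge 1$ (the case $d=1$ being the one of main interest). For $1\le n\le N$ and $h\in\mathbb R$ consider on $\ell^2(\mathbb Z^{nd})$, $\mathbb{Z}^{nd}\cong(\mathbb Z^d)^n$, the random $n$-particle Hamiltonian $$\mathbf H^{(n)}_h(\omega)=-\mathbf\Delta+\sum_{j=1}^nV(x_j,\omega)+h\,\mathbf U(\mathbf x),\qquad \mathbf U(\mathbf x)=\sum_{1\le i<j\le n}\Phi(|x_i-x_j|),$$ where $(\mathbf\Delta\Psi)(\mathbf x)=\sum_{|\mathbf y-\mathbf x|_1=1}(\Psi(\mathbf y)-\Psi(\mathbf x))$, $|\cdot|$ is the max-norm, and $\Phi:\mathbb N\to\mathbb R$ satisfies $\operatorname{supp}\Phi\subset[0,r_0]$ for some $r_0\in\mathbb N$. The variables $V(x,\cdot)$, $x\in\mathbb Z^d$, are i.i.d. on a probability space $(\Omega,\mathfrak B,\mathbb P)$; their common law $\mu$ is carried by $[-M,M]$, $0<M<\infty$, and has a density $\rho$ with $\sup_x|\rho(x)(1+|x|)^{1+\kappa}|<\infty$ for some $\kappa\in(0,1)$. Let $\|\mathbf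 U\|$ be the supremum norm of the $N$-particle interaction and $$I=\bigl[-1-N(4d+M)-|h|\|\mathbf U\|,\;N(4d+M)+|h|\|\mathbf U\|+1\bigr].$$ Let $\mathbf C^{(n)}_L(\mathbf u)=\{\mathbf x\in\mathbb Z^{nd}:|\mathbf x-\mathbf u|\le L\}$, let $\partial^-\mathbf C^{(n)}_L(\mathbf u)$ be the set of $\mathbf v$ at max-norm distance exactly $1$ from $\mathbb Z^{nd}\setminus\mathbf C^{(n)}_L(\mathbf u)$, and let $\mathbf H$ be the restriction of $\mathbf H_h^{(n)}(\omega)$ to $\ell^2(\mathbf C^{(n)}_L(\mathbf u))$ with matrix elements $\mathbf H^{(n)}_h(\mathbf x,\mathbf y)$, $\mathbf x,\mathbf y\in\mathbf C^{(n)}_L(\mathbf u)$. The cube $\mathbf C^{(n)}_L(\mathbf u)$ is *$(E,m,h)$-nonsingular* if $E\notin\sigma(\mathbf H)$ and $$\max_{\mathbf v\in\partial^-\mathbf C^{(n)}_L(\mathbf u)}\bigl|(\mathbf H-E)^{-1}(\mathbf u,\mathbf v)\bigr|\le e^{-\gamma(m,L,n)L},\qquad \gamma(m,L,n)=m(1+L^{-1/8})^{N-n+1},$$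 and *$(E,m,h)$-singular* otherwise. For an integer $L_0$ put $L_{k+1}=\lfloor L_k^{3/2}\rfloor+1$, $k\ge0$. **Theorem (fixed-energy multiscale induction step).** Let $0<\theta<1/3$, $p>\frac{6Nd}{1-3\theta}$ and $0<m\le\frac1{2^{N+1}\,12Nd}$. There is $L^*$, depending only on $N,d,\Phi,r_0,\mu,M,\theta,p,m$, such that for every $L_0\ge L^*$, every such random field $V$ with law $\mu$, every $h\in\mathbb R$, every $1\le n\le N$ and every $k\ge0$ the following holds. Assume that for all $E\in I$ (i) for all $1\le n'<n$ and all $\mathbf u'\in\mathbb Z^{n'd}$, $\ \mathbb P\{\mathbf C^{(n')}_{L_k}(\mathbf u')\text{ is }(E,m,h)\text{-singular}\}\le L_k^{-2p\,4^{N-n'}(1+\theta)^k}$; (ii) for all $\mathbf u\in\mathbb Z^{nd}$, $\ \mathbb P\{\mathbf C^{(n)}_{L_k}(\mathbf u)\text{ is }(E,m,h)\text{-singular}\}\le L_k^{-2p\,4^{N-n}(1+\theta)^k}$. Then for all $E\in I$ and all $\mathbf u\in\mathbb Z^{nd}$ $$\mathbb P\{\mathbf C^{(n)}_{L_{k+1}}(\mathbf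 u)\text{ is }(E,m,h)\text{-singular}\}\le L_{k+1}^{-2p\,4^{N-n}(1+\theta)^{k+1}}.$$ -/

import Mathlib

open MeasureTheory ProbabilityTheory

namespace MultiParticleAnderson

noncomputable section

/-- A site of the one-particle lattice `ℤ^d`. -/
abbrev Site (d : ℕ) : Type := Fin d → ℤ

/-- A configuration `x = (x₁, …, xₙ)` of `n` particles, a point of `(ℤ^d)^n ≅ ℤ^{nd}`.
Its metric in Mathlib is the one of the max-norm `|x - y|`. -/
abbrev Config (n d : ℕ) : Type := Fin n → Site d

/-- The max-norm distance `|x - y|` of two sites, as a natural number. -/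
def siteDist {d : ℕ} (x y : Site d) : ℕ :=
  Finset.univ.sup fun a => (x a - y a).natAbs

/-- The distance `|x - y|₁` of two configurations. -/
def l1Dist {n d : ℕ} (x y : Config n d) : ℕ :=
  ∑ j, ∑ a, (x j a - y j a).natAbs

/-- The interaction potential `U(x) = ∑_{i < j} Φ(|x_i - x_j|)` of `n` particles. -/
def interaction (d : ℕ) (Φ : ℕ → ℝ) (n : ℕ) (x : Config n d) : ℝ :=
  ∑ i, ∑ j, if i < j then Φ (siteDist (x i) (x j)) else 0

/-- `‖U‖`, the supremum norm of the interaction potential of `N` particles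
(`U` is bounded when `Φ` has finite support). -/
def interactionNorm (d : ℕ) (Φ : ℕ → ℝ) (N : ℕ) : ℝ :=
  ⨆ x : Config N d, |interaction d Φ N x|

/-- The matrix of the nearest-neighbour Laplacian
`(Δ Ψ)(x) = ∑_{|y - x|₁ = 1} Ψ(y) - 2 d n Ψ(x)` on `ℤ^{nd}`. -/
def laplacian (n d : ℕ) : Matrix (Config n d) (Config n d) ℝ := fun x y =>
  if l1Dist x y = 1 then 1 else if x = y then -(2 * d * n : ℝ) else 0

/-- The matrix of the `n`-particle Hamiltonian `H = -Δ + ∑_j W(x_j) + h U` for a realization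
`W : ℤ^d → ℝ` of the external potential. -/
def hamiltonian {d : ℕ} (Φ : ℕ → ℝ) (W : Site d → ℝ) (h : ℝ) (n : ℕ) :
    Matrix (Config n d) (Config n d) ℝ :=
  -laplacian n d + Matrix.diagonal (fun x => ∑ j, W (x j))
    + h • Matrix.diagonal (interaction d Φ n)

/-- The `n`-particle cube `C_L(u) = {x : |x - u| ≤ L}`. -/
def cube {n d : ℕ} (u : Config n d) (L : ℕ) : Finset (Config n d) :=
  Finset.Icc (fun j a => u j a - L) (fun j a => u j a + L)

theorem mem_cube {n d : ℕ} {u x : Config n d} {L : ℕ} : x ∈ cube u L ↔ dist x u ≤ L := by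
  simp only [cube, Finset.mem_Icc, Pi.le_def, dist_pi_le_iff (Nat.cast_nonneg L), Int.dist_eq,
    abs_le]
  constructor
  · rintro ⟨h1, h2⟩ j a
    have := h1 j a
    have := h2 j a
    constructor <;> norm_cast <;> omega
  · intro h
    refine ⟨fun j a => ?_, fun j a => ?_⟩
    · have := (h j a).1
      norm_cast at this
      omega
    · have := (h j a).2
      norm_cast at this
      omega

theorem center_mem_cube {n d : ℕ} (u : Config n d) (L : ℕ) : u ∈ cube u L := by
  simp [mem_cube]

/-- The internal boundary `∂⁻C_L(u) = {v : dist(v, ℤ^{nd} ∖ C_L(u)) = 1}`. -/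
def innerBoundary {n d : ℕ} (u : Config n d) (L : ℕ) : Set (Config n d) :=
  {v | Metric.infDist v ((cube u L : Set (Config n d))ᶜ) = 1}

/-- The restriction of the Hamiltonian to `C_L(u)` (simple boundary conditions), an operator on
`ℓ²(C_L(u))`. -/
def cubeHamiltonian {n d : ℕ} (Φ : ℕ → ℝ) (W : Site d → ℝ) (h : ℝ) (u : Config n d) (L : ℕ) :
    Matrix (cube u L) (cube u L) ℝ :=
  (hamiltonian Φ W h n).submatrix Subtype.val Subtype.val

/-- The Green functions: the matrix of the resolvent `(H_{C_L(u)} - E)⁻¹`, meaningful when `E` is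
not in the spectrum of `H_{C_L(u)}`. -/
def green {n d : ℕ} (Φ : ℕ → ℝ) (W : Site d → ℝ) (h : ℝ) (u : Config n d) (L : ℕ) (E : ℝ) :
    Matrix (cube u L) (cube u L) ℝ :=
  (cubeHamiltonian Φ W h u L - E • (1 : Matrix (cube u L) (cube u L) ℝ))⁻¹

/-- `γ(m, L, n) = m (1 + L^{-1/8})^{N - n + 1}`. -/
def decayRate (N : ℕ) (m : ℝ) (L n : ℕ) : ℝ :=
  m * (1 + (L : ℝ) ^ (-(1 / 8 : ℝ))) ^ (N - n + 1)

/-- The cube `C_L(u)` is `(E, m, h)`-nonsingular. -/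
def IsNonsingular {n d : ℕ} (N : ℕ) (Φ : ℕ → ℝ) (W : Site d → ℝ) (E m h : ℝ)
    (u : Config n d) (L : ℕ) : Prop :=
  E ∉ spectrum ℝ (cubeHamiltonian Φ W h u L) ∧
    ∀ v : cube u L, (v : Config n d) ∈ innerBoundary u L →
      |green Φ W h u L E ⟨u, center_mem_cube u L⟩ v| ≤ Real.exp (-(decayRate N m L n * L))

/-- The cube `C_L(u)` is `(E, m, h)`-singular. -/
def IsSingular {n d : ℕ} (N : ℕ) (Φ : ℕ → ℝ) (W : Site d → ℝ) (E m h : ℝ)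
    (u : Config n d) (L : ℕ) : Prop :=
  ¬ IsNonsingular N Φ W E m h u L

/-- The length scales `L_{k+1} = ⌊L_k^{3/2}⌋ + 1`. -/
def scale (L₀ : ℕ) : ℕ → ℕ
  | 0 => L₀
  | k + 1 => ⌊(scale L₀ k : ℝ) ^ (3 / 2 : ℝ)⌋₊ + 1

/-- The energy interval
`I = [-1 - N(4d + M) - |h| ‖U‖, N(4d + M) + |h| ‖U‖ + 1]`. -/
def energyInterval (N d : ℕ) (Φ : ℕ → ℝ) (M h : ℝ) : Set ℝ :=
  Set.Icc (-1 - N * (4 * d + M) - |h| * interactionNorm d Φ N)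
    (N * (4 * d + M) + |h| * interactionNorm d Φ N + 1)

/-- The conditions on the single-site law `μ`: it is a probability measure carried by `[-M, M]`,
and it has a (bounded) density `ρ` with `sup_x |ρ(x) (1 + |x|)^{1 + κ}| < ∞` for
some `κ ∈ (0, 1)`. -/
structure IsAdmissibleLaw (μ : Measure ℝ) (M : ℝ) : Prop where
  isProbabilityMeasure : IsProbabilityMeasure μ
  bound_pos : 0 < M
  supported : μ (Set.Icc (-M) M)ᶜ = 0
  density : ∃ ρ : ℝ → ℝ, Measurable ρ ∧ (∀ x, 0 ≤ ρ x) ∧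
    μ = volume.withDensity (fun x => ENNReal.ofReal (ρ x)) ∧
    ∃ κ ∈ Set.Ioo (0 : ℝ) 1, ∃ C : ℝ, ∀ x, |ρ x * (1 + |x|) ^ (1 + κ)| ≤ C

/-- `V : ℤ^d × Ω → ℝ` is a field of i.i.d. random variables with common law `μ`. -/
structure IsIIDField {d : ℕ} {Ω : Type*} [MeasurableSpace Ω] (P : Measure Ω)
    (V : Site d → Ω → ℝ) (μ : Measure ℝ) : Prop where
  measurable : ∀ x, Measurable (V x)
  law : ∀ x, P.map (V x) = μ
  indep : iIndepFun V P

/-- The `n`-particle singularity bound at scale `L_k`: for all `E ∈ I` and all `u ∈ ℤ^{nd}`,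
`P{C_{L_k}(u) is (E, m, h)-singular} ≤ L_k^{-2p 4^{N-n} (1+θ)^k}`. -/
def SingularityBound {d : ℕ} {Ω : Type*} [MeasurableSpace Ω] (P : Measure Ω)
    (V : Site d → Ω → ℝ) (N : ℕ) (Φ : ℕ → ℝ) (M h m p θ : ℝ) (L₀ n k : ℕ) : Prop :=
  ∀ E ∈ energyInterval N d Φ M h, ∀ u : Config n d,
    P.real {ω | IsSingular N Φ (fun x => V x ω) E m h u (scale L₀ k)} ≤
      (scale L₀ k : ℝ) ^ (-(2 * p * 4 ^ (N - n) * (1 + θ) ^ k))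

end

end MultiParticleAnderson

open MultiParticleAnderson

/-!
The cube `C_{L'}(u)`, `L' = L_{k+1}`, is compared with its subcubes of radius `L = L_k`. It is
nonsingular at `E` unless one of three improbable things happens.

* *A resonance*: `E` is within `exp (-√L)` of the spectrum of `C_{L'}(u)` or of a cube of radius
  `8NL` centred in it. Ordered eigenvalues are monotone in the potential
  (`eigenvalues_le_of_form_le`), and raising the potential by a constant `c` raises each of them by
  exactly `n c`. Raising it site by site instead bounds the probability that an eigenvalue lies in a
  given short interval (`IsIIDField.measure_crossing_le`, `IsIIDField.wegner`). The resulting bound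
  `O(exp (-√L))`, up to powers of `L`, suffices because the exponent `2p 4^{N-n} (1+θ)^k` is
  `O(log L_k)`.

* *A singular partially interactive subcube*: its particles form two groups that do not interact
  and see disjoint parts of the potential. The Hamiltonian is a Kronecker sum, and its
  resolvent is a superposition of resolvents of one group at the energies `E - λ`, with `λ` an
  eigenvalue of the other group (`abs_resolvent_kroneckerSum_le`, `isNonsingular_of_split`). By
  independence, `λ` may be treated as fixed, and the bound for fewer particles applies when `E - λ`
  is in `I`. Outside `I` the diagonal of `H - E` dominates, and the maximum principle makes all
  cubes nonsingular (`isNonsingular_of_notMem_energyInterval`). The factor `4^{N-n}` in the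
  exponents makes this event negligible.

* *Two distant singular fully interactive subcubes*: in such a cube all particles are linked by
  chains of bounded gaps, so that distant ones depend on disjoint parts of the potential and
  are independent (`disjoint_siteSet_of_not_isPartiallyInteractive`). The square of the
  probability at scale `L` suffices, because `(3/2)(1 + θ) < 2` and `p > 6Nd/(1 - 3θ)` pays for
  the number of pairs (`eventually_probability_le`).

Otherwise all singular subcubes have centres in one cluster of radius `8NL`. The geometric resolvent
inequality (`abs_le_of_solution`) then gives a gain of `exp (-γ L + O(√L))` whenever the
distance to `u` grows by `L + 1` off the cluster, the cluster itself being crossed at the cost of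
one nonresonant resolvent (`abs_green_le_of_cluster`). The total loss is of relative order `L^{-1/2}`,
less than the difference of `γ(m, L, n)` and `γ(m, L', n)`, of order `L^{-1/8}`
(`eventually_decay`).
-/

namespace MultiParticleAnderson

open Matrix Kronecker

/-! ### Spectral theory of real symmetric matrices -/

section Spectral

variable {ι : Type*} [Fintype ι] [DecidableEq ι]

theorem inner_mulVec_eq_sum {A : Matrix ι ι ℝ} (hA : A.IsHermitian) (v : EuclideanSpace ℝ ι) :
    v.ofLp ⬝ᵥ A *ᵥ v.ofLp = ∑ j, hA.eigenvalues j * (inner ℝ (hA.eigenvectorBasis j) v) ^ 2 := by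
  have h1 : v.ofLp ⬝ᵥ A *ᵥ v.ofLp = inner ℝ v (WithLp.toLp 2 (A *ᵥ v.ofLp)) := by
    simp [EuclideanSpace.inner_eq_star_dotProduct, dotProduct_comm]
  rw [h1, ← hA.eigenvectorBasis.sum_inner_mul_inner]
  refine Finset.sum_congr rfl fun j _ => ?_
  have h2 : inner ℝ (hA.eigenvectorBasis j) (WithLp.toLp 2 (A *ᵥ v.ofLp)) =
      hA.eigenvalues j * inner ℝ (hA.eigenvectorBasis j) v := by
    have hT : Aᵀ = A := by rw [← conjTranspose_eq_transpose_of_trivial]; exact hA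
    have h3 := hA.mulVec_eigenvectorBasis j
    simp only [EuclideanSpace.inner_eq_star_dotProduct, star_trivial]
    rw [dotProduct_comm, dotProduct_mulVec, ← mulVec_transpose, hT, h3, smul_dotProduct,
      smul_eq_mul, dotProduct_comm]
  rw [h2, real_inner_comm]
  ring

/-- Weyl's comparison principle: the ordered eigenvalues are monotone with respect to the order of
quadratic forms, up to an additive constant. -/
theorem eigenvalues_le_of_form_le {A B : Matrix ι ι ℝ} (hA : A.IsHermitian) (hB : B.IsHermitian)
    {c : ℝ} (h : ∀ v : ι → ℝ, v ⬝ᵥ A *ᵥ v ≤ v ⬝ᵥ B *ᵥ v + c * (v ⬝ᵥ v)) (i : ι) :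
    hA.eigenvalues i ≤ hB.eigenvalues i + c := by
  classical
  set φ : Fin (Fintype.card ι) ≃ ι := Fintype.equivOfCardEq (Fintype.card_fin _) with hφ
  have anti : ∀ {D : Matrix ι ι ℝ} (hD : D.IsHermitian) {j : ι}, φ.symm j ≤ φ.symm i →
      hD.eigenvalues i ≤ hD.eigenvalues j := fun hD j hj => hD.eigenvalues₀_antitone hj
  have anti' : ∀ {D : Matrix ι ι ℝ} (hD : D.IsHermitian) {j : ι}, φ.symm i ≤ φ.symm j →
      hD.eigenvalues j ≤ hD.eigenvalues i := fun hD j hj => hD.eigenvalues₀_antitone hj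
  -- `v` is orthogonal to the upper eigenvectors of `B` and to the lower eigenvectors of `A`:
  -- one linear condition for each index different from `i`.
  let T : EuclideanSpace ℝ ι →ₗ[ℝ] ({j // j ≠ i} → ℝ) := LinearMap.pi fun j =>
    if φ.symm j < φ.symm i then (innerSL ℝ (hB.eigenvectorBasis j)).toLinearMap
    else (innerSL ℝ (hA.eigenvectorBasis j)).toLinearMap
  have hker : LinearMap.ker T ≠ ⊥ := by
    apply LinearMap.ker_ne_bot_of_finrank_lt
    have : 0 < Fintype.card ι := Fintype.card_pos_iff.2 ⟨i⟩
    simp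
    omega
  obtain ⟨v, hv, hv0⟩ := (Submodule.ne_bot_iff _).1 hker
  have hv' : ∀ j : {j // j ≠ i}, T v j = 0 := fun j => by
    rw [LinearMap.mem_ker.1 hv]; rfl
  have hpos : 0 < v.ofLp ⬝ᵥ v.ofLp := by
    have : v.ofLp ⬝ᵥ v.ofLp = ‖v‖ ^ 2 := by
      rw [← real_inner_self_eq_norm_sq]; rfl
    rw [this]; positivity
  have hnorm : ∀ {D : Matrix ι ι ℝ} (hD : D.IsHermitian),
      v.ofLp ⬝ᵥ v.ofLp = ∑ j, (inner ℝ (hD.eigenvectorBasis j) v) ^ 2 := fun hD => by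
    have : v.ofLp ⬝ᵥ v.ofLp = inner ℝ v v := rfl
    rw [this, ← hD.eigenvectorBasis.sum_inner_mul_inner]
    exact Finset.sum_congr rfl fun j _ => by rw [real_inner_comm]; ring
  have hlow : hA.eigenvalues i * (v.ofLp ⬝ᵥ v.ofLp) ≤ v.ofLp ⬝ᵥ A *ᵥ v.ofLp := by
    rw [inner_mulVec_eq_sum hA, hnorm hA, Finset.mul_sum]
    refine Finset.sum_le_sum fun j _ => ?_
    by_cases hj : φ.symm j ≤ φ.symm i
    · exact mul_le_mul_of_nonneg_right (anti hA hj) (sq_nonneg _)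
    · have hne : j ≠ i := by rintro rfl; exact hj le_rfl
      have := hv' ⟨j, hne⟩
      simp only [T, LinearMap.pi_apply, if_neg (fun h => hj (le_of_lt h))] at this
      have h0 : inner ℝ (hA.eigenvectorBasis j) v = 0 := this
      simp [h0]
  have hup : v.ofLp ⬝ᵥ B *ᵥ v.ofLp ≤ hB.eigenvalues i * (v.ofLp ⬝ᵥ v.ofLp) := by
    rw [inner_mulVec_eq_sum hB, hnorm hB, Finset.mul_sum]
    refine Finset.sum_le_sum fun j _ => ?_
    by_cases hj : φ.symm i ≤ φ.symm j
    · exact mul_le_mul_of_nonneg_right (anti' hB hj) (sq_nonneg _)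
    · have hne : j ≠ i := by rintro rfl; exact hj le_rfl
      have := hv' ⟨j, hne⟩
      simp only [T, LinearMap.pi_apply, if_pos (not_le.1 hj)] at this
      have h0 : inner ℝ (hB.eigenvectorBasis j) v = 0 := this
      simp [h0]
  have := h v.ofLp
  exact le_of_mul_le_mul_right (by linarith [add_mul (hB.eigenvalues i) c (v.ofLp ⬝ᵥ v.ofLp)]) hpos

/-- An orthogonal matrix of eigenvectors, in a form suited for matrix computations. -/
theorem exists_orthogonal_diagonalization {A : Matrix ι ι ℝ} (hA : A.IsHermitian) :
    ∃ U : Matrix ι ι ℝ, U * Uᵀ = 1 ∧ A * U = U * diagonal hA.eigenvalues := by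
  refine ⟨hA.eigenvectorUnitary, ?_, ?_⟩
  · have := Unitary.coe_mul_star_self hA.eigenvectorUnitary
    simpa [star_eq_conjTranspose] using this
  · ext x j
    have := congrFun (hA.mulVec_eigenvectorBasis j) x
    simp only [mul_diagonal, IsHermitian.eigenvectorUnitary_apply]
    rw [Pi.smul_apply, smul_eq_mul, mul_comm] at this
    exact this

theorem sum_abs_mul_le_one {U : Matrix ι ι ℝ} (hU : U * Uᵀ = 1) (x y : ι) :
    ∑ j, |U x j * U y j| ≤ 1 := by
  have h : ∀ x, ∑ j, U x j * U x j = 1 := fun x => by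
    have := congrFun (congrFun hU x) x
    simpa [mul_apply] using this
  have h2 : ∑ j, |U x j * U y j| ≤ ∑ j, (U x j * U x j + U y j * U y j) / 2 := by
    refine Finset.sum_le_sum fun j _ => ?_
    rw [abs_mul]
    nlinarith [sq_nonneg (|U x j| - |U y j|), abs_mul_abs_self (U x j), abs_mul_abs_self (U y j)]
  rw [← Finset.sum_div, Finset.sum_add_distrib, h, h] at h2
  linarith

theorem notMem_spectrum_of_mul_eq_one {A G : Matrix ι ι ℝ} {E : ℝ}
    (h : (A - E • (1 : Matrix ι ι ℝ)) * G = 1) : E ∉ spectrum ℝ A := by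
  rw [spectrum.notMem_iff, Algebra.algebraMap_eq_smul_one, ← neg_sub, IsUnit.neg_iff]
  exact (isUnit_iff_isUnit_det _).2 (isUnit_det_of_right_inverse h)

theorem isUnit_sub_of_notMem_spectrum {A : Matrix ι ι ℝ} {E : ℝ} (h : E ∉ spectrum ℝ A) :
    IsUnit (A - E • (1 : Matrix ι ι ℝ)).det := by
  rw [spectrum.notMem_iff, Algebra.algebraMap_eq_smul_one, ← neg_sub, IsUnit.neg_iff] at h
  exact (isUnit_iff_isUnit_det _).1 h

/-- The entries of the resolvent are bounded by the inverse distance of `E` to the spectrum. -/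
theorem abs_resolvent_le {A : Matrix ι ι ℝ} (hA : A.IsHermitian) {E δ : ℝ} (hδ : 0 < δ)
    (h : ∀ j, δ ≤ |hA.eigenvalues j - E|) (x y : ι) :
    E ∉ spectrum ℝ A ∧ |(A - E • (1 : Matrix ι ι ℝ))⁻¹ x y| ≤ δ⁻¹ := by
  obtain ⟨U, hU, hAU⟩ := exists_orthogonal_diagonalization hA
  have hne : ∀ j, hA.eigenvalues j - E ≠ 0 := fun j h0 => by
    have := h j; rw [h0, abs_zero] at this; linarith
  have hG : (A - E • (1 : Matrix ι ι ℝ)) *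
      (U * diagonal (fun j => (hA.eigenvalues j - E)⁻¹) * Uᵀ) = 1 := by
    have : (A - E • (1 : Matrix ι ι ℝ)) * U = U * diagonal (fun j => hA.eigenvalues j - E) := by
      rw [sub_mul, hAU, ← diagonal_sub, mul_sub, ← smul_one_eq_diagonal]
      simp
    rw [← mul_assoc, ← mul_assoc, this, mul_assoc U, diagonal_mul_diagonal]
    simp [hne, hU]
  refine ⟨notMem_spectrum_of_mul_eq_one hG, ?_⟩
  rw [inv_eq_right_inv hG, mul_apply]
  simp only [mul_diagonal, transpose_apply]
  calc |∑ j, U x j * (hA.eigenvalues j - E)⁻¹ * U y j|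
      ≤ ∑ j, |U x j * (hA.eigenvalues j - E)⁻¹ * U y j| := Finset.abs_sum_le_sum_abs _ _
    _ ≤ ∑ j, δ⁻¹ * |U x j * U y j| := by
        refine Finset.sum_le_sum fun j _ => ?_
        rw [mul_right_comm, abs_mul, mul_comm, abs_inv]
        exact mul_le_mul_of_nonneg_right (inv_anti₀ hδ (h j)) (abs_nonneg _)
    _ ≤ δ⁻¹ := by
        rw [← Finset.mul_sum]
        exact mul_le_of_le_one_right (inv_nonneg.2 hδ.le) (sum_abs_mul_le_one hU x y)

/-- The resolvent of a Kronecker sum `H₁ ⊗ 1 + 1 ⊗ H₂` is a superposition of resolvents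
of `H₁` at the energies `E - λ`, `λ ∈ σ(H₂)`, hence it is bounded by them. -/
theorem abs_resolvent_kroneckerSum_le {ι₁ ι₂ : Type*} [Fintype ι₁] [DecidableEq ι₁] [Fintype ι₂]
    [DecidableEq ι₂] (H₁ : Matrix ι₁ ι₁ ℝ) {H₂ : Matrix ι₂ ι₂ ℝ} (h₂ : H₂.IsHermitian) {E b : ℝ}
    (hE : ∀ j, E - h₂.eigenvalues j ∉ spectrum ℝ H₁) :
    E ∉ spectrum ℝ (H₁ ⊗ₖ (1 : Matrix ι₂ ι₂ ℝ) + (1 : Matrix ι₁ ι₁ ℝ) ⊗ₖ H₂) ∧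
    ∀ x y : ι₁ × ι₂,
      (∀ j, |(H₁ - (E - h₂.eigenvalues j) • (1 : Matrix ι₁ ι₁ ℝ))⁻¹ x.1 y.1| ≤ b) →
      |(H₁ ⊗ₖ (1 : Matrix ι₂ ι₂ ℝ) + (1 : Matrix ι₁ ι₁ ℝ) ⊗ₖ H₂
        - E • (1 : Matrix (ι₁ × ι₂) (ι₁ × ι₂) ℝ))⁻¹ x y| ≤ b := by
  obtain ⟨U, hU, hAU⟩ := exists_orthogonal_diagonalization h₂
  set G₁ : ι₂ → Matrix ι₁ ι₁ ℝ :=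
    fun j => (H₁ - (E - h₂.eigenvalues j) • (1 : Matrix ι₁ ι₁ ℝ))⁻¹ with hG₁
  set Q : ι₂ → Matrix ι₂ ι₂ ℝ := fun j => vecMulVec (fun x => U x j) (fun y => U y j) with hQ
  have hQ1 : ∑ j, Q j = 1 := by
    rw [← hU]; ext x y
    simp [hQ, Matrix.sum_apply, vecMulVec_apply, mul_apply]
  have hQ2 : ∀ j, H₂ * Q j = h₂.eigenvalues j • Q j := fun j => by
    ext x y
    have h3 := congrFun (congrFun hAU x) j
    rw [mul_diagonal, mul_apply] at h3
    simp only [hQ, mul_apply, vecMulVec_apply, Matrix.smul_apply, smul_eq_mul, ← mul_assoc]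
    rw [← Finset.sum_mul, h3]
    ring
  have hGG : ∀ j, H₁ * G₁ j = 1 + (E - h₂.eigenvalues j) • G₁ j := fun j => by
    have := mul_nonsing_inv _ (isUnit_sub_of_notMem_spectrum (hE j))
    rw [sub_mul, smul_mul_assoc, one_mul] at this
    rw [← this, sub_add_cancel]
  have hG : (H₁ ⊗ₖ (1 : Matrix ι₂ ι₂ ℝ) + (1 : Matrix ι₁ ι₁ ℝ) ⊗ₖ H₂
        - E • (1 : Matrix (ι₁ × ι₂) (ι₁ × ι₂) ℝ)) * (∑ j, G₁ j ⊗ₖ Q j) = 1 := by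
    rw [Finset.mul_sum]
    have : ∀ j ∈ Finset.univ, (H₁ ⊗ₖ (1 : Matrix ι₂ ι₂ ℝ) + (1 : Matrix ι₁ ι₁ ℝ) ⊗ₖ H₂
        - E • (1 : Matrix (ι₁ × ι₂) (ι₁ × ι₂) ℝ)) * (G₁ j ⊗ₖ Q j) = 1 ⊗ₖ Q j := fun j _ => by
      rw [sub_mul, add_mul, ← mul_kronecker_mul, ← mul_kronecker_mul, one_mul, one_mul, hQ2, hGG,
        smul_mul_assoc, one_mul, add_kronecker, smul_kronecker, kronecker_smul]
      module
    rw [Finset.sum_congr rfl this]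
    ext x y
    have h4 : (∑ j, Q j) x.2 y.2 = (1 : Matrix ι₂ ι₂ ℝ) x.2 y.2 := by rw [hQ1]
    rw [Matrix.sum_apply] at h4
    simp only [Matrix.sum_apply, kroneckerMap_apply]
    rw [← Finset.mul_sum, h4, ← one_kronecker_one]
    rfl
  refine ⟨notMem_spectrum_of_mul_eq_one hG, fun x y hb => ?_⟩
  rw [inv_eq_right_inv hG]
  simp only [Matrix.sum_apply, kroneckerMap_apply]
  calc |∑ j, G₁ j x.1 y.1 * Q j x.2 y.2|
      ≤ ∑ j, |G₁ j x.1 y.1 * Q j x.2 y.2| := Finset.abs_sum_le_sum_abs _ _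
    _ ≤ ∑ j, b * |U x.2 j * U y.2 j| := by
        refine Finset.sum_le_sum fun j _ => ?_
        rw [abs_mul]
        exact mul_le_mul_of_nonneg_right (hb j) (abs_nonneg _)
    _ ≤ b := by
        rw [← Finset.mul_sum]
        have h0 : 0 ≤ b := (abs_nonneg _).trans (hb x.2)
        exact mul_le_of_le_one_right h0 (sum_abs_mul_le_one hU _ _)

end Spectral

/-! ### Cubes, boundaries and nearest neighbours -/

section Lattice

theorem natAbs_sub_comm (x y : ℤ) : (x - y).natAbs = (y - x).natAbs := by omega

variable {n d : ℕ}

theorem mem_cube_iff {u x : Config n d} {L : ℕ} :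
    x ∈ cube u L ↔ ∀ j a, (x j a - u j a).natAbs ≤ L := by
  simp only [cube, Finset.mem_Icc, Pi.le_def]
  constructor
  · rintro ⟨h1, h2⟩ j a
    have := h1 j a
    have := h2 j a
    omega
  · exact fun h => ⟨fun j a => by have := h j a; omega, fun j a => by have := h j a; omega⟩

theorem mem_cube_comm {u x : Config n d} {L : ℕ} : x ∈ cube u L ↔ u ∈ cube x L := by
  simp only [mem_cube_iff]
  exact forall₂_congr fun j a => by rw [natAbs_sub_comm]

theorem mem_cube_add {u x z : Config n d} {r s : ℕ} (hx : x ∈ cube u r) (hz : z ∈ cube x s) :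
    z ∈ cube u (r + s) := by
  rw [mem_cube_iff] at *
  intro j a
  have := hx j a
  have := hz j a
  omega

theorem cube_subset_cube {u x : Config n d} {r s t : ℕ} (hx : x ∈ cube u r) (h : r + s ≤ t) :
    cube x s ⊆ cube u t := by
  intro z hz
  have := mem_cube_add hx hz
  rw [mem_cube_iff] at *
  exact fun j a => (this j a).trans h

theorem cube_mono {u : Config n d} {r s : ℕ} (h : r ≤ s) : cube u r ⊆ cube u s :=
  cube_subset_cube (center_mem_cube u 0) (by omega)

theorem card_cube (u : Config n d) (L : ℕ) : (cube u L).card = (2 * L + 1) ^ (n * d) := by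
  have h : ∀ z : ℤ, (z + L + 1 - (z - L)).toNat = 2 * L + 1 := fun z => by omega
  simp only [cube, Pi.card_Icc, Int.card_Icc, h, Finset.prod_const, Finset.card_univ,
    Fintype.card_fin, ← pow_mul]
  rw [mul_comm d n]

theorem dist_le_iff_natAbs {x z : Config n d} {r : ℕ} :
    dist x z ≤ r ↔ ∀ j a, (x j a - z j a).natAbs ≤ r := by
  rw [← mem_cube, mem_cube_iff]

theorem mem_innerBoundary_iff {u v : Config n d} {L : ℕ} (hv : v ∈ cube u L) :
    v ∈ innerBoundary u L ↔ ∃ j a, (v j a - u j a).natAbs = L := by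
  have hv' := mem_cube_iff.1 hv
  constructor
  · intro h
    by_contra! hne
    have h' : Metric.infDist v ((cube u L : Set (Config n d))ᶜ) = 1 := h
    have hnonempty : ((cube u L : Set (Config n d))ᶜ).Nonempty := by
      rw [Set.nonempty_iff_ne_empty]
      intro h0
      rw [h0, Metric.infDist_empty] at h'
      exact zero_ne_one h'
    obtain ⟨z, hz, hlt⟩ := (Metric.infDist_lt_iff (r := 2) hnonempty).1 (by rw [h']; norm_num)
    apply hz
    have hz1 : ∀ j a, (v j a - z j a).natAbs ≤ 1 := by
      intro j a
      have h1 : dist (v j a) (z j a) < 2 :=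
        lt_of_le_of_lt ((dist_le_pi_dist (v j) (z j) a).trans (dist_le_pi_dist v z j)) hlt
      rw [Int.dist_eq] at h1
      have h2 : |v j a - z j a| < 2 := by exact_mod_cast h1
      rw [abs_lt] at h2
      omega
    rw [Finset.mem_coe, mem_cube_iff]
    intro j a
    have := hz1 j a
    have := hv' j a
    have := hne j a
    omega
  · rintro ⟨j, a, hja⟩
    -- moving the coordinate `(j, a)` away from the centre leaves the cube
    set s : ℤ := if 0 ≤ v j a - u j a then 1 else -1 with hs
    set z : Config n d := Function.update v j (Function.update (v j) a (v j a + s)) with hz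
    have hzc : z ∈ ((cube u L : Set (Config n d))ᶜ) := by
      intro h
      have := mem_cube_iff.1 (Finset.mem_coe.1 h) j a
      simp only [hz, Function.update_self] at this
      split_ifs at hs <;> omega
    have hdist : dist v z ≤ (1 : ℕ) := by
      rw [dist_le_iff_natAbs]
      intro j' a'
      by_cases hj : j' = j
      · subst hj
        by_cases ha : a' = a
        · subst ha
          simp only [hz, Function.update_self]
          split_ifs at hs <;> omega
        · simp [hz, ha]
      · simp [hz, hj]
    refine le_antisymm ((Metric.infDist_le_dist_of_mem hzc).trans (by simpa using hdist)) ?_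
    refine (Metric.le_infDist ⟨z, hzc⟩).2 fun y hy => ?_
    by_contra! hlt
    apply hy
    have : y = v := by
      funext j' a'
      have h1 : dist (v j' a') (y j' a') < 1 :=
        lt_of_le_of_lt ((dist_le_pi_dist (v j') (y j') a').trans (dist_le_pi_dist v y j')) hlt
      rw [Int.dist_eq] at h1
      have h2 : |v j' a' - y j' a'| < 1 := by exact_mod_cast h1
      rw [abs_lt] at h2
      omega
    rw [this]
    exact hv

theorem l1Dist_comm (x y : Config n d) : l1Dist x y = l1Dist y x := by
  exact Finset.sum_congr rfl fun j _ => Finset.sum_congr rfl fun a _ => natAbs_sub_comm _ _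

theorem natAbs_le_l1Dist (x y : Config n d) (j : Fin n) (a : Fin d) :
    (x j a - y j a).natAbs ≤ l1Dist x y :=
  (Finset.single_le_sum (f := fun a => (x j a - y j a).natAbs) (fun _ _ => Nat.zero_le _)
    (Finset.mem_univ a)).trans
  (Finset.single_le_sum (f := fun j => ∑ a, (x j a - y j a).natAbs) (fun _ _ => Nat.zero_le _)
    (Finset.mem_univ j))

theorem l1Dist_eq_zero {x y : Config n d} : l1Dist x y = 0 ↔ x = y := by
  simp only [l1Dist, Finset.sum_eq_zero_iff, Finset.mem_univ, true_imp_iff, Int.natAbs_eq_zero,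
    sub_eq_zero, funext_iff]

/-- A nearest neighbour differs in one coordinate, by `±1`. -/
theorem exists_update_of_l1Dist_eq_one {x y : Config n d} (h : l1Dist x y = 1) :
    ∃ j a, ∃ s ∈ ({1, -1} : Finset ℤ),
      y = Function.update x j (Function.update (x j) a (x j a + s)) := by
  have hsum : ∑ p : Fin n × Fin d, (x p.1 p.2 - y p.1 p.2).natAbs = 1 := by
    rw [Fintype.sum_prod_type]; exact h
  obtain ⟨p, -, hp⟩ : ∃ p ∈ (Finset.univ : Finset (Fin n × Fin d)),
      (x p.1 p.2 - y p.1 p.2).natAbs ≠ 0 := by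
    by_contra! h0
    rw [Finset.sum_eq_zero h0] at hsum
    exact zero_ne_one hsum
  rw [← Finset.add_sum_erase _ _ (Finset.mem_univ p)] at hsum
  have h0 : ∑ q ∈ Finset.univ.erase p, (x q.1 q.2 - y q.1 q.2).natAbs = 0 := by omega
  have h1 : (x p.1 p.2 - y p.1 p.2).natAbs = 1 := by omega
  rw [Finset.sum_eq_zero_iff] at h0
  refine ⟨p.1, p.2, y p.1 p.2 - x p.1 p.2, ?_, ?_⟩
  · simp only [Finset.mem_insert, Finset.mem_singleton]
    omega
  · funext j a
    by_cases hj : j = p.1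
    · subst hj
      by_cases ha : a = p.2
      · subst ha
        simp
      · have : (x p.1 a - y p.1 a).natAbs = 0 := h0 (p.1, a) (by simp [Prod.ext_iff, ha])
        simp only [Function.update_self, ne_eq, ha, not_false_eq_true, Function.update_of_ne]
        omega
    · have : (x j a - y j a).natAbs = 0 := h0 (j, a) (by simp [Prod.ext_iff, hj])
      simp only [ne_eq, hj, not_false_eq_true, Function.update_of_ne]
      omega

theorem card_filter_l1Dist_eq_one_le (Λ : Finset (Config n d)) (x : Config n d) :
    (Λ.filter fun y => l1Dist x y = 1).card ≤ 2 * n * d := by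
  have hsub : (Λ.filter fun y => l1Dist x y = 1) ⊆
      ((Finset.univ : Finset (Fin n × Fin d)) ×ˢ ({1, -1} : Finset ℤ)).image fun q =>
        Function.update x q.1.1 (Function.update (x q.1.1) q.1.2 (x q.1.1 q.1.2 + q.2)) := by
    intro y hy
    obtain ⟨j, a, s, hs, rfl⟩ := exists_update_of_l1Dist_eq_one (Finset.mem_filter.1 hy).2
    exact Finset.mem_image.2 ⟨((j, a), s), by simpa using hs, rfl⟩
  refine (Finset.card_le_card hsub).trans (Finset.card_image_le.trans ?_)
  rw [Finset.card_product]
  simp only [Finset.card_univ, Fintype.card_prod, Fintype.card_fin]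
  rw [Finset.card_pair (by norm_num)]
  linarith

end Lattice

/-! ### The Hamiltonian -/

section Hamiltonian

variable {n d : ℕ} (Φ : ℕ → ℝ) (W : Site d → ℝ) (h : ℝ)

theorem hamiltonian_apply_ne {x y : Config n d} (hxy : x ≠ y) :
    hamiltonian Φ W h n x y = if l1Dist x y = 1 then -1 else 0 := by
  simp only [hamiltonian, laplacian, Matrix.add_apply, Matrix.neg_apply, Matrix.smul_apply,
    diagonal_apply_ne _ hxy, if_neg hxy]
  split_ifs <;> simp

theorem hamiltonian_apply_self (x : Config n d) :
    hamiltonian Φ W h n x x = 2 * d * n + ∑ j, W (x j) + h * interaction d Φ n x := by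
  have : ¬ l1Dist x x = 1 := by rw [l1Dist_eq_zero.2 rfl]; norm_num
  simp [hamiltonian, laplacian, this]

theorem hamiltonian_comm (x y : Config n d) :
    hamiltonian Φ W h n x y = hamiltonian Φ W h n y x := by
  by_cases hxy : x = y
  · rw [hxy]
  · rw [hamiltonian_apply_ne _ _ _ hxy, hamiltonian_apply_ne _ _ _ (Ne.symm hxy), l1Dist_comm]

theorem isHermitian_cubeHamiltonian (u : Config n d) (L : ℕ) :
    (cubeHamiltonian Φ W h u L).IsHermitian := by
  ext x y
  simp [cubeHamiltonian, hamiltonian_comm Φ W h y.1 x.1]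

/-- The off-diagonal part of the Hamiltonian, acting on a function bounded by `b` near `x`. -/
theorem sum_offDiag_le {Λ : Finset (Config n d)} {x : Config n d} (hx : x ∉ Λ)
    {g : Config n d → ℝ} {b : ℝ} (hb0 : 0 ≤ b) (hb : ∀ z ∈ Λ, l1Dist x z = 1 → |g z| ≤ b) :
    |∑ z ∈ Λ, hamiltonian Φ W h n x z * g z| ≤ 2 * n * d * b := by
  calc |∑ z ∈ Λ, hamiltonian Φ W h n x z * g z|
      ≤ ∑ z ∈ Λ, |hamiltonian Φ W h n x z * g z| := Finset.abs_sum_le_sum_abs _ _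
    _ ≤ ∑ z ∈ Λ, if l1Dist x z = 1 then b else 0 := by
        refine Finset.sum_le_sum fun z hz => ?_
        rw [hamiltonian_apply_ne _ _ _ (fun h0 : x = z => hx (h0 ▸ hz))]
        split_ifs with h1
        · simpa using hb z hz h1
        · simp
    _ = ((Λ.filter fun y => l1Dist x y = 1).card : ℝ) * b := by
        rw [← Finset.sum_filter, Finset.sum_const, nsmul_eq_mul]
    _ ≤ 2 * n * d * b := by
        refine mul_le_mul_of_nonneg_right ?_ hb0
        exact_mod_cast card_filter_l1Dist_eq_one_le Λ x

/-- The columns of the resolvent solve `(H - E) g = δ_y`. -/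
theorem sum_mul_green {u : Config n d} {L : ℕ} {E : ℝ}
    (hE : E ∉ spectrum ℝ (cubeHamiltonian Φ W h u L)) (x y : cube u L) :
    ∑ z : cube u L, hamiltonian Φ W h n x z * green Φ W h u L E z y =
      E * green Φ W h u L E x y + if x = y then 1 else 0 := by
  have h1 := mul_nonsing_inv _ (isUnit_sub_of_notMem_spectrum hE)
  have h2 := congrFun (congrFun h1 x) y
  rw [sub_mul, smul_mul_assoc, one_mul, Matrix.sub_apply, Matrix.smul_apply, mul_apply,
    one_apply, smul_eq_mul] at h2
  change ∑ z : cube u L, hamiltonian Φ W h n x z * green Φ W h u L E z y -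
    E * green Φ W h u L E x y = _ at h2
  linarith

/-- Geometric resolvent inequality: a solution `g` of `(H_Λ - E) g = 0` in a cube `C ⊆ Λ` is
controlled by the Green function of `C` at the inner boundary of `C` and by the values of `g`
at the sites of `Λ` adjacent to `C`. -/
theorem abs_le_of_solution {x : Config n d} {L : ℕ} {Λ : Finset (Config n d)}
    (hΛ : cube x L ⊆ Λ) {E : ℝ} (hE : E ∉ spectrum ℝ (cubeHamiltonian Φ W h x L))
    {g : Config n d → ℝ}
    (hg : ∀ v ∈ cube x L, ∑ z ∈ Λ, hamiltonian Φ W h n v z * g z = E * g v)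
    {a b : ℝ} (ha0 : 0 ≤ a) (hb0 : 0 ≤ b) (x₀ : cube x L)
    (ha : ∀ v : cube x L, (v : Config n d) ∈ innerBoundary x L → |green Φ W h x L E x₀ v| ≤ a)
    (hb : ∀ z ∈ Λ, z ∉ cube x L → z ∈ cube x (L + 1) → |g z| ≤ b) :
    |g x₀| ≤ (2 * L + 1 : ℝ) ^ (n * d) * (2 * n * d) * a * b := by
  set r : cube x L → ℝ := fun v => ∑ z ∈ Λ \ cube x L, hamiltonian Φ W h n v z * g z with hr
  have heq : ∀ v : cube x L,
      ((cubeHamiltonian Φ W h x L - E • (1 : Matrix (cube x L) (cube x L) ℝ)) *ᵥ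
        fun z => g z) v = - r v := by
    intro v
    have h1 := hg v v.2
    rw [← Finset.sum_sdiff hΛ, ← Finset.sum_coe_sort (cube x L)] at h1
    rw [sub_mulVec, smul_mulVec, one_mulVec, Pi.sub_apply, Pi.smul_apply, smul_eq_mul, mulVec,
      dotProduct]
    change ∑ z : cube x L, hamiltonian Φ W h n v z * g z - E * g v = _
    linarith
  have hsol : g x₀ = ∑ v, green Φ W h x L E x₀ v * (- r v) := by
    have h1 := nonsing_inv_mul _ (isUnit_sub_of_notMem_spectrum hE)
    have h2 : (fun z : cube x L => g z) = green Φ W h x L E *ᵥ (fun v => - r v) := by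
      rw [← funext heq, mulVec_mulVec, green, h1, one_mulVec]
    exact congrFun h2 x₀
  have hterm : ∀ v, |green Φ W h x L E x₀ v * (- r v)| ≤ a * (2 * n * d * b) := by
    intro v
    by_cases hv : (v : Config n d) ∈ innerBoundary x L
    · rw [abs_mul, abs_neg]
      refine mul_le_mul (ha v hv) ?_ (abs_nonneg _) ha0
      refine sum_offDiag_le Φ W h (by simp [v.2]) hb0 fun z hz h1 => ?_
      rw [Finset.mem_sdiff] at hz
      refine hb z hz.1 hz.2 (mem_cube_add v.2 (mem_cube_iff.2 fun j a => ?_))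
      rw [natAbs_sub_comm, ← h1]
      exact natAbs_le_l1Dist _ _ j a
    · have : r v = 0 := by
        refine Finset.sum_eq_zero fun z hz => ?_
        rw [Finset.mem_sdiff] at hz
        have hne : (v : Config n d) ≠ z := fun h => hz.2 (h ▸ v.2)
        rw [hamiltonian_apply_ne _ _ _ hne, if_neg, zero_mul]
        intro h1
        apply hz.2
        rw [mem_innerBoundary_iff v.2] at hv
        push Not at hv
        rw [mem_cube_iff]
        intro j a
        have h2 := hv j a
        have h3 := mem_cube_iff.1 v.2 j a
        have h4 := natAbs_le_l1Dist (v : Config n d) z j a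
        omega
      rw [this]
      simp only [neg_zero, mul_zero, abs_zero]
      positivity
  rw [hsol]
  calc |∑ v, green Φ W h x L E x₀ v * (- r v)|
      ≤ ∑ v, |green Φ W h x L E x₀ v * (- r v)| := Finset.abs_sum_le_sum_abs _ _
    _ ≤ ∑ _v : cube x L, a * (2 * n * d * b) := Finset.sum_le_sum fun v _ => hterm v
    _ = (2 * L + 1 : ℝ) ^ (n * d) * (2 * n * d) * a * b := by
        rw [Finset.sum_const, Finset.card_univ, Fintype.card_coe, card_cube, nsmul_eq_mul]
        push_cast
        ring

end Hamiltonian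

/-! ### Dependence of the Hamiltonian on the random potential -/

section Potential

variable {n d : ℕ}

/-- The sites of `ℤ^d` occupied by some particle of some configuration of the cube `C_L(u)`. -/
noncomputable def siteSet (u : Config n d) (L : ℕ) : Finset (Site d) :=
  (cube u L ×ˢ (Finset.univ : Finset (Fin n))).image fun q => q.1 q.2

theorem apply_mem_siteSet {u x : Config n d} {L : ℕ} (hx : x ∈ cube u L) (j : Fin n) :
    x j ∈ siteSet u L :=
  Finset.mem_image.2 ⟨(x, j), by simpa using hx, rfl⟩

theorem exists_of_mem_siteSet {u : Config n d} {L : ℕ} {s : Site d} (hs : s ∈ siteSet u L) :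
    ∃ j, ∀ a, (s a - u j a).natAbs ≤ L := by
  obtain ⟨⟨x, j⟩, hq, rfl⟩ := Finset.mem_image.1 hs
  exact ⟨j, fun a => mem_cube_iff.1 (Finset.mem_product.1 hq).1 j a⟩

theorem card_siteSet_le (u : Config n d) (L : ℕ) :
    (siteSet u L).card ≤ n * (cube u L).card := by
  refine Finset.card_image_le.trans ?_
  rw [Finset.card_product, Finset.card_univ, Fintype.card_fin, mul_comm]

/-- Extension by zero of a potential given on a finite set of sites. -/
noncomputable def extendZero {d : ℕ} {S : Finset (Site d)} (w : S → ℝ) : Site d → ℝ :=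
  fun x => if hx : x ∈ S then w ⟨x, hx⟩ else 0

theorem extendZero_apply {S : Finset (Site d)} (w : S → ℝ) {x : Site d} (hx : x ∈ S) :
    extendZero w x = w ⟨x, hx⟩ := dif_pos hx

theorem cubeHamiltonian_congr (Φ : ℕ → ℝ) (h : ℝ) {u : Config n d} {L : ℕ} {W W' : Site d → ℝ}
    (hW : ∀ s ∈ siteSet u L, W s = W' s) :
    cubeHamiltonian Φ W h u L = cubeHamiltonian Φ W' h u L := by
  ext x y
  simp only [cubeHamiltonian, submatrix_apply]
  by_cases hxy : (x : Config n d) = y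
  · rw [← hxy, hamiltonian_apply_self, hamiltonian_apply_self,
      Finset.sum_congr rfl fun j _ => hW _ (apply_mem_siteSet x.2 j)]
  · rw [hamiltonian_apply_ne _ _ _ hxy, hamiltonian_apply_ne _ _ _ hxy]

theorem cubeHamiltonian_restrict (Φ : ℕ → ℝ) (W : Site d → ℝ) (h : ℝ) (u : Config n d) (L : ℕ) :
    cubeHamiltonian Φ (extendZero fun s : siteSet u L => W s) h u L =
      cubeHamiltonian Φ W h u L :=
  cubeHamiltonian_congr Φ h fun _ hs => extendZero_apply _ hs

theorem isSingular_congr {N : ℕ} {Φ : ℕ → ℝ} {E m h : ℝ} {u : Config n d} {L : ℕ}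
    {W W' : Site d → ℝ} (hW : cubeHamiltonian Φ W h u L = cubeHamiltonian Φ W' h u L) :
    IsSingular N Φ W E m h u L ↔ IsSingular N Φ W' E m h u L := by
  simp only [IsSingular, IsNonsingular, green, hW]

/-- The `i`-th eigenvalue of `H_{C_L(u)}`, as a function of the potential. -/
noncomputable def cubeEigenvalue (Φ : ℕ → ℝ) (h : ℝ) (u : Config n d) (L : ℕ) (i : cube u L)
    (W : Site d → ℝ) : ℝ :=
  (isHermitian_cubeHamiltonian Φ W h u L).eigenvalues i

theorem cubeEigenvalue_congr {Φ : ℕ → ℝ} {h : ℝ} {u : Config n d} {L : ℕ} (i : cube u L)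
    {W W' : Site d → ℝ} (hW : ∀ s ∈ siteSet u L, W s = W' s) :
    cubeEigenvalue Φ h u L i W = cubeEigenvalue Φ h u L i W' := by
  have := cubeHamiltonian_congr Φ h hW
  unfold cubeEigenvalue
  congr 1

/-- Each of the `n` particles feels the potential, so that raising it by `c` raises the
eigenvalues by at most `n c`. -/
theorem cubeEigenvalue_le_add {Φ : ℕ → ℝ} {h : ℝ} {u : Config n d} {L : ℕ} (i : cube u L)
    {W W' : Site d → ℝ} {c : ℝ} (hW : ∀ s ∈ siteSet u L, W s ≤ W' s + c) :
    cubeEigenvalue Φ h u L i W ≤ cubeEigenvalue Φ h u L i W' + n * c := by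
  refine eigenvalues_le_of_form_le _ _ (fun v => ?_) i
  have hH : cubeHamiltonian Φ W h u L = cubeHamiltonian Φ W' h u L +
      diagonal fun x : cube u L => ∑ j, (W (x.1 j) - W' (x.1 j)) := by
    ext x y
    simp only [cubeHamiltonian, submatrix_apply, Matrix.add_apply]
    by_cases hxy : x = y
    · subst hxy
      rw [hamiltonian_apply_self, hamiltonian_apply_self, diagonal_apply_eq,
        Finset.sum_sub_distrib]
      ring
    · rw [diagonal_apply_ne _ hxy, hamiltonian_apply_ne _ _ _ (Subtype.coe_ne_coe.2 hxy),
        hamiltonian_apply_ne _ _ _ (Subtype.coe_ne_coe.2 hxy), add_zero]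
  rw [hH, add_mulVec, dotProduct_add]
  gcongr
  simp only [dotProduct, mulVec_diagonal, Finset.mul_sum]
  refine Finset.sum_le_sum fun x _ => ?_
  have h1 : ∑ j, (W (x.1 j) - W' (x.1 j)) ≤ n * c := by
    have : ∀ j ∈ Finset.univ, W (x.1 j) - W' (x.1 j) ≤ c := fun j _ => by
      linarith [hW _ (apply_mem_siteSet x.2 j)]
    simpa using Finset.sum_le_sum this
  nlinarith [mul_self_nonneg (v x)]

theorem cubeEigenvalue_mono {Φ : ℕ → ℝ} {h : ℝ} {u : Config n d} {L : ℕ} (i : cube u L) :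
    Monotone (cubeEigenvalue Φ h u L i) := fun W W' hW => by
  simpa using cubeEigenvalue_le_add (Φ := Φ) (h := h) i (W := W) (W' := W') (c := 0)
    fun s _ => by simpa using hW s

theorem cubeEigenvalue_add_const {Φ : ℕ → ℝ} {h : ℝ} {u : Config n d} {L : ℕ} (i : cube u L)
    (W : Site d → ℝ) (c : ℝ) :
    cubeEigenvalue Φ h u L i (fun s => W s + c) = cubeEigenvalue Φ h u L i W + n * c := by
  refine le_antisymm (cubeEigenvalue_le_add i fun s _ => le_rfl) ?_
  have := cubeEigenvalue_le_add (Φ := Φ) (h := h) i (W := W) (W' := fun s => W s + c) (c := -c)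
    fun s _ => by simp
  linarith

theorem continuous_cubeEigenvalue_extendZero {Φ : ℕ → ℝ} {h : ℝ} {u : Config n d} {L : ℕ}
    (i : cube u L) (S : Finset (Site d)) :
    Continuous fun w : S → ℝ => cubeEigenvalue Φ h u L i (extendZero w) := by
  refine (LipschitzWith.of_le_add_mul (n : NNReal) fun w w' => ?_).continuous
  refine cubeEigenvalue_le_add i fun s _ => ?_
  unfold extendZero
  split_ifs with hs
  · have := (abs_le.1 ((Real.dist_eq _ _).symm.le.trans (dist_le_pi_dist w w' ⟨s, hs⟩))).2
    linarith
  · simp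

theorem measurable_det_of_entries {α ι : Type*} [MeasurableSpace α] [Fintype ι] [DecidableEq ι]
    {A : α → Matrix ι ι ℝ} (hA : ∀ x y, Measurable fun q => A q x y) :
    Measurable fun q => (A q).det := by
  simp only [det_apply']
  exact Finset.measurable_sum _ fun σ _ =>
    measurable_const.mul (Finset.measurable_prod _ fun i _ => hA _ _)

theorem measurable_inv_of_entries {α ι : Type*} [MeasurableSpace α] [Fintype ι] [DecidableEq ι]
    {A : α → Matrix ι ι ℝ} (hA : ∀ x y, Measurable fun q => A q x y) (x y : ι) :
    Measurable fun q => (A q)⁻¹ x y := by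
  simp only [inv_def, Matrix.smul_apply, Ring.inverse_eq_inv', smul_eq_mul, adjugate_apply]
  refine (measurable_det_of_entries hA).inv.mul (measurable_det_of_entries fun x' y' => ?_)
  by_cases hx : x' = y
  · simp only [hx, updateRow_self]
    exact measurable_const
  · simp only [updateRow_ne hx]
    exact hA x' y'

/-- Joint measurability of the singularity event in the potential and the energy. -/
theorem measurableSet_isSingular {Φ : ℕ → ℝ} {N : ℕ} {m h : ℝ} {u : Config n d} {L : ℕ}
    (S : Finset (Site d)) :
    MeasurableSet {q : (S → ℝ) × ℝ | IsSingular N Φ (extendZero q.1) q.2 m h u L} := by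
  have hH : ∀ x y : cube u L, Measurable fun q : (S → ℝ) × ℝ =>
      (cubeHamiltonian Φ (extendZero q.1) h u L -
        q.2 • (1 : Matrix (cube u L) (cube u L) ℝ)) x y := by
    have hext : ∀ s, Measurable fun q : (S → ℝ) × ℝ => extendZero q.1 s := fun s => by
      unfold extendZero
      split_ifs with hs
      · fun_prop
      · fun_prop
    intro x y
    simp only [Matrix.sub_apply, Matrix.smul_apply, cubeHamiltonian, submatrix_apply, hamiltonian,
      Matrix.add_apply, diagonal_apply]
    refine Measurable.sub (Measurable.add (Measurable.add measurable_const ?_) measurable_const)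
      (by fun_prop)
    split_ifs
    · exact Finset.measurable_sum _ fun j _ => hext _
    · exact measurable_const
  have hns : {q : (S → ℝ) × ℝ | IsSingular N Φ (extendZero q.1) q.2 m h u L} =
      {q | (cubeHamiltonian Φ (extendZero q.1) h u L -
          q.2 • (1 : Matrix (cube u L) (cube u L) ℝ)).det ≠ 0 ∧
        ∀ v : cube u L, (v : Config n d) ∈ innerBoundary u L →
          |(cubeHamiltonian Φ (extendZero q.1) h u L -
            q.2 • (1 : Matrix (cube u L) (cube u L) ℝ))⁻¹ ⟨u, center_mem_cube u L⟩ v| ≤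
            Real.exp (-(decayRate N m L n * L))}ᶜ := by
    ext q
    simp only [IsSingular, IsNonsingular, Set.mem_ofPred_eq, Set.mem_compl_iff, green]
    refine not_congr (and_congr_left' ?_)
    rw [spectrum.notMem_iff, Algebra.algebraMap_eq_smul_one, ← neg_sub, IsUnit.neg_iff,
      isUnit_iff_isUnit_det, isUnit_iff_ne_zero]
  have hbd : MeasurableSet {q : (S → ℝ) × ℝ |
      ∀ v : cube u L, (v : Config n d) ∈ innerBoundary u L →
        |(cubeHamiltonian Φ (extendZero q.1) h u L -
          q.2 • (1 : Matrix (cube u L) (cube u L) ℝ))⁻¹ ⟨u, center_mem_cube u L⟩ v| ≤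
          Real.exp (-(decayRate N m L n * L))} := by
    simp only [Set.ofPred_forall]
    exact MeasurableSet.iInter fun v => MeasurableSet.iInter fun _ =>
      measurableSet_le (measurable_inv_of_entries hH _ v).abs measurable_const
  rw [hns]
  exact MeasurableSet.compl (MeasurableSet.inter
    ((measurable_det_of_entries hH) (measurableSet_singleton 0).compl) hbd)

end Potential

/-! ### Independence and the Wegner estimate -/

section Wegner

variable {Ω : Type*} [MeasurableSpace Ω] {P : Measure Ω}

/-- A bound on all sections of an event, with respect to independent variables, bounds the
probability of the event. -/
theorem measure_le_of_forall_section_le [IsProbabilityMeasure P] {α β : Type*}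
    [MeasurableSpace α] [MeasurableSpace β]
    {X : Ω → α} {Y : Ω → β} (hX : Measurable X) (hY : Measurable Y) (hXY : IndepFun X Y P)
    {A : Set (α × β)} (hA : MeasurableSet A) {c : ENNReal}
    (hc : ∀ y, P {ω | (X ω, y) ∈ A} ≤ c) : P {ω | (X ω, Y ω) ∈ A} ≤ c := by
  have := Measure.isProbabilityMeasure_map (μ := P) hX.aemeasurable
  have := Measure.isProbabilityMeasure_map (μ := P) hY.aemeasurable
  have h1 : P {ω | (X ω, Y ω) ∈ A} = P.map (fun ω => (X ω, Y ω)) A :=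
    (Measure.map_apply (hX.prodMk hY) hA).symm
  rw [h1, (indepFun_iff_map_prod_eq_prod_map_map hX.aemeasurable hY.aemeasurable).1 hXY,
    Measure.prod_apply_symm hA]
  calc ∫⁻ y, P.map X ((fun x => (x, y)) ⁻¹' A) ∂(P.map Y) ≤ ∫⁻ _y, c ∂(P.map Y) := by
        refine lintegral_mono fun y => ?_
        rw [Measure.map_apply hX (measurable_prodMk_right hA)]
        exact hc y
    _ = c := by simp

theorem IsAdmissibleLaw.exists_le_volume {μ : Measure ℝ} {M : ℝ} (hμ : IsAdmissibleLaw μ M) :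
    ∃ C : ℝ, 0 ≤ C ∧ ∀ A, μ A ≤ ENNReal.ofReal C * volume A := by
  obtain ⟨ρ, hρ, hρ0, hμρ, κ, hκ, C, hC⟩ := hμ.density
  have hC0 : 0 ≤ C := (abs_nonneg _).trans (hC 0)
  refine ⟨C, hC0, fun A => ?_⟩
  have hle : ∀ x, ρ x ≤ C := fun x => by
    have h1 : 1 ≤ (1 + |x|) ^ (1 + κ) :=
      Real.one_le_rpow (by linarith [abs_nonneg x]) (by linarith [hκ.1])
    calc ρ x ≤ ρ x * (1 + |x|) ^ (1 + κ) := le_mul_of_one_le_right (hρ0 x) h1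
      _ ≤ _ := le_abs_self _
      _ ≤ C := hC x
  have h2 : μ ≤ ENNReal.ofReal C • volume := by
    rw [hμρ, ← withDensity_const]
    exact withDensity_mono (Filter.Eventually.of_forall fun x => ENNReal.ofReal_le_ofReal (hle x))
  exact h2 A

/-- A monotone function can cross a level only on a set of diameter at most `δ` while its argument
is shifted by `δ`. -/
theorem measure_crossing_le {μ : Measure ℝ} {C : ENNReal} (hμ : ∀ A, μ A ≤ C * volume A)
    {f : ℝ → ℝ} (hf : Monotone f) (δ b : ℝ) :
    μ {t | f t ≤ b ∧ b < f (t + δ)} ≤ C * ENNReal.ofReal δ := by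
  refine (hμ _).trans ?_
  gcongr
  refine (Real.volume_le_diam _).trans (Metric.ediam_le fun s hs t ht => ?_)
  have key : ∀ {s t : ℝ}, b < f (s + δ) → f t ≤ b → t - s ≤ δ := fun {s t} hs ht => by
    by_contra! hlt
    have := hf (show s + δ ≤ t by linarith)
    linarith
  rw [edist_dist, Real.dist_eq]
  exact ENNReal.ofReal_le_ofReal (abs_le.2 ⟨by linarith [key hs.2 ht.1], key ht.2 hs.1⟩)

variable {d : ℕ} {V : Site d → Ω → ℝ} {μ : Measure ℝ}

theorem IsIIDField.measurable_restrict (hV : IsIIDField P V μ) (S : Finset (Site d)) :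
    Measurable fun ω => fun s : S => V s ω :=
  measurable_pi_iff.2 fun s => hV.measurable s

theorem IsIIDField.indepFun_restrict (hV : IsIIDField P V μ) {S T : Finset (Site d)}
    (hST : Disjoint S T) : IndepFun (fun ω => fun s : S => V s ω) (fun ω => fun t : T => V t ω) P :=
  hV.indep.indepFun_finset S T hST hV.measurable

/-- Stollmann's lemma: the potential is raised by `δ` site by site, and each step contributes
a crossing probability at most `C δ`. -/
theorem IsIIDField.measure_crossing_le [IsProbabilityMeasure P] (hV : IsIIDField P V μ)
    {C : ENNReal} (hμ : ∀ A, μ A ≤ C * volume A) {f : (Site d → ℝ) → ℝ} (hf : Monotone f)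
    (S : Finset (Site d)) (hfS : ∀ W W', (∀ s ∈ S, W s = W' s) → f W = f W')
    (hmeas : Measurable fun w : S → ℝ => f (extendZero w)) (δ b : ℝ)
    (T : Finset (Site d)) :
    P {ω | f (fun s => V s ω) ≤ b ∧ b < f (fun s => V s ω + if s ∈ T then δ else 0)} ≤
      T.card * (C * ENNReal.ofReal δ) := by
  classical
  induction T using Finset.induction_on with
  | empty =>
    have : {ω | f (fun s => V s ω) ≤ b ∧
        b < f (fun s => V s ω + if s ∈ (∅ : Finset (Site d)) then δ else 0)} = ∅ := by
      ext ω
      simp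
    rw [this]
    simp
  | insert x T hx ih =>
    set S' := S.erase x
    -- the potential with value `t` at `x` and raised on `T`, as a function on `S`
    set q : ℝ × (S' → ℝ) → (S → ℝ) := fun p s =>
      if hs : (s : Site d) = x then p.1
      else p.2 ⟨s, Finset.mem_erase.2 ⟨hs, s.2⟩⟩ + if (s : Site d) ∈ T then δ else 0 with hq
    have hqm : Measurable q := by
      refine measurable_pi_iff.2 fun s => ?_
      simp only [hq]
      split_ifs <;> fun_prop
    have hqmono : ∀ y, Monotone fun t => f (extendZero (q (t, y))) := by
      refine fun y t t' htt => hf fun s => ?_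
      simp only [extendZero, hq]
      split_ifs
      · exact htt
      all_goals exact le_rfl
    have hA : MeasurableSet {p : ℝ × (S' → ℝ) | f (extendZero (q p)) ≤ b ∧
        b < f (extendZero (q (p.1 + δ, p.2)))} := by
      have h2 : Measurable fun p : ℝ × (S' → ℝ) => f (extendZero (q (p.1 + δ, p.2))) :=
        hmeas.comp (hqm.comp (by fun_prop))
      exact (measurableSet_le (hmeas.comp hqm) measurable_const).inter
        (measurableSet_lt measurable_const h2)
    have hind : IndepFun (V x) (fun ω => fun s : S' => V s ω) P := by
      have h1 := hV.indepFun_restrict (S := {x}) (T := S') (by simp [S'])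
      exact h1.comp (φ := fun w : ({x} : Finset (Site d)) → ℝ => w ⟨x, by simp⟩) (ψ := id)
        (measurable_pi_apply _) measurable_id
    have hstep := measure_le_of_forall_section_le (hV.measurable x) (hV.measurable_restrict S')
      hind hA (c := C * ENNReal.ofReal δ) (fun y => by
        have h1 : P {ω | (V x ω, y) ∈ {p : ℝ × (S' → ℝ) | f (extendZero (q p)) ≤ b ∧
            b < f (extendZero (q (p.1 + δ, p.2)))}} =
            P.map (V x) {t | f (extendZero (q (t, y))) ≤ b ∧
              b < f (extendZero (q (t + δ, y)))} := by
          rw [Measure.map_apply (hV.measurable x)]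
          · rfl
          · exact measurable_prodMk_right hA
        rw [h1, hV.law x]
        exact MultiParticleAnderson.measure_crossing_le hμ (hqmono y) δ b)
    have hsub : {ω | f (fun s => V s ω) ≤ b ∧
          b < f (fun s => V s ω + if s ∈ insert x T then δ else 0)} ⊆
        {ω | f (fun s => V s ω) ≤ b ∧ b < f (fun s => V s ω + if s ∈ T then δ else 0)} ∪
        {ω | (V x ω, fun s : S' => V s ω) ∈ {p : ℝ × (S' → ℝ) | f (extendZero (q p)) ≤ b ∧
          b < f (extendZero (q (p.1 + δ, p.2)))}} := by
      rintro ω ⟨h1, h2⟩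
      by_cases h3 : b < f (fun s => V s ω + if s ∈ T then δ else 0)
      · exact Or.inl ⟨h1, h3⟩
      · refine Or.inr ⟨?_, ?_⟩
        · refine le_of_eq_of_le (hfS _ _ fun s hs => ?_) (not_lt.1 h3)
          rw [extendZero_apply _ hs]
          simp only [hq]
          split_ifs with h4 h5 h5
          · exact absurd (h4 ▸ h5) hx
          · rw [h4, add_zero]
          · rfl
          · rfl
        · refine lt_of_lt_of_eq h2 (hfS _ _ fun s hs => ?_)
          rw [extendZero_apply _ hs]
          simp only [hq, Finset.mem_insert]
          by_cases h4 : s = x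
          · simp [h4]
          · simp [h4]
    calc _ ≤ _ := measure_mono hsub
      _ ≤ _ := measure_union_le _ _
      _ ≤ T.card * (C * ENNReal.ofReal δ) + C * ENNReal.ofReal δ := add_le_add ih hstep
      _ = _ := by
        rw [Finset.card_insert_of_notMem hx]
        push_cast
        ring

/-- Wegner estimate: the energy `E` is within `ε` of the spectrum of `H_{C_L(u)}` with probability
`O(ε |C_L(u)|²)`, uniformly in the interaction. -/
theorem IsIIDField.wegner [IsProbabilityMeasure P] (hV : IsIIDField P V μ)
    {C : ℝ} (hC : 0 ≤ C) (hμ : ∀ A, μ A ≤ ENNReal.ofReal C * volume A) (Φ : ℕ → ℝ) (h : ℝ)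
    {n : ℕ} (hn : 1 ≤ n) (u : Config n d) (L : ℕ) (E : ℝ) {ε : ℝ} (hε : 0 ≤ ε) :
    P.real {ω | ∃ i, |cubeEigenvalue Φ h u L i (fun s => V s ω) - E| < ε} ≤
      2 * C * ε * ((cube u L).card : ℝ) ^ 2 := by
  have hn0 : (0 : ℝ) < n := by exact_mod_cast hn
  set δ : ℝ := 2 * ε / n with hδ
  have hδ0 : 0 ≤ δ := by positivity
  have hi : ∀ i : cube u L, P {ω | |cubeEigenvalue Φ h u L i (fun s => V s ω) - E| < ε} ≤
      ENNReal.ofReal ((siteSet u L).card * (C * δ)) := by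
    intro i
    have h1 := hV.measure_crossing_le hμ (cubeEigenvalue_mono (Φ := Φ) (h := h) i) (siteSet u L)
      (fun W W' hW => cubeEigenvalue_congr i hW)
      (continuous_cubeEigenvalue_extendZero i _).measurable δ (E + ε)
      (siteSet u L)
    rw [ENNReal.ofReal_mul (by positivity), ENNReal.ofReal_mul hC, ENNReal.ofReal_natCast]
    refine (measure_mono fun ω hω => ?_).trans h1
    have hω' := abs_lt.1 (Set.mem_ofPred_eq ▸ hω)
    refine ⟨by linarith, ?_⟩
    rw [cubeEigenvalue_congr i (W' := fun s => V s ω + δ) (fun s hs => by simp [hs]),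
      cubeEigenvalue_add_const]
    have : n * δ = 2 * ε := by rw [hδ]; field_simp
    linarith
  have hcard : ((siteSet u L).card : ℝ) ≤ n * (cube u L).card := by
    exact_mod_cast card_siteSet_le u L
  have h2 : P {ω | ∃ i, |cubeEigenvalue Φ h u L i (fun s => V s ω) - E| < ε} ≤
      ENNReal.ofReal (2 * C * ε * ((cube u L).card : ℝ) ^ 2) := by
    rw [Set.ofPred_exists]
    refine (measure_iUnion_fintype_le _ _).trans ((Finset.sum_le_sum fun i _ => hi i).trans ?_)
    rw [Finset.sum_const, nsmul_eq_mul, Finset.card_univ, Fintype.card_coe,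
      ← ENNReal.ofReal_natCast, ← ENNReal.ofReal_mul (by positivity)]
    apply ENNReal.ofReal_le_ofReal
    calc ((cube u L).card : ℝ) * ((siteSet u L).card * (C * δ))
        ≤ (cube u L).card * (n * (cube u L).card * (C * δ)) := by gcongr
      _ = (n * δ) * C * ((cube u L).card : ℝ) ^ 2 := by ring
      _ = 2 * C * ε * ((cube u L).card : ℝ) ^ 2 := by
        have : n * δ = 2 * ε := by rw [hδ]; field_simp
        rw [this]; ring
  exact ENNReal.toReal_le_of_le_ofReal (by positivity) h2

end Wegner

/-! ### Decay of the Green function in the presence of one bad cluster -/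

section Deterministic

variable {n d : ℕ}

/-- The combinatorial constant `|C_L| · 2nd` of the geometric resolvent inequality. -/
noncomputable def griConst (n d L : ℕ) : ℝ := (2 * L + 1 : ℝ) ^ (n * d) * (2 * n * d)

theorem one_le_griConst (hn : 1 ≤ n) (hd : 1 ≤ d) (L : ℕ) : 1 ≤ griConst n d L := by
  have h1 : (1 : ℝ) ≤ (2 * L + 1 : ℝ) ^ (n * d) :=
    one_le_pow₀ (by linarith [(Nat.cast_nonneg L : (0 : ℝ) ≤ L)])
  have hn' : (1 : ℝ) ≤ n := by exact_mod_cast hn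
  have hd' : (1 : ℝ) ≤ d := by exact_mod_cast hd
  have h2 : (1 : ℝ) ≤ n * d := by nlinarith
  have h3 : (1 : ℝ) ≤ 2 * n * d := by nlinarith
  unfold griConst
  nlinarith

/-- A distance-`s` step that gains a factor `Q` can be repeated. -/
theorem bound_iterate {u : Config n d} {g : Config n d → ℝ} {Q : ℝ} (hQ : 0 ≤ Q) {s lo hi : ℕ}
    (hstep : ∀ r b, lo ≤ r → r + s ≤ hi → 0 ≤ b → (∀ z ∈ cube u (r + s), |g z| ≤ b) →
      ∀ z ∈ cube u r, |g z| ≤ Q * b) :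
    ∀ (t : ℕ) (b : ℝ), lo + t * s ≤ hi → 0 ≤ b → (∀ z ∈ cube u hi, |g z| ≤ b) →
      ∀ z ∈ cube u lo, |g z| ≤ Q ^ t * b := by
  have key : ∀ (t : ℕ) (b : ℝ), lo + t * s ≤ hi → 0 ≤ b →
      (∀ z ∈ cube u (lo + t * s), |g z| ≤ b) → ∀ z ∈ cube u lo, |g z| ≤ Q ^ t * b := by
    intro t
    induction t with
    | zero => intro b _ _ hb; simpa using hb
    | succ t ih =>
      intro b ht hb0 hb
      have h1 : lo + (t + 1) * s = lo + t * s + s := by ring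
      rw [h1] at ht hb
      have := ih (Q * b) (by omega) (by positivity) (hstep _ b (by omega) ht hb0 hb)
      intro z hz
      rw [pow_succ, mul_assoc]
      exact this z hz
  exact fun t b ht hb0 hb => key t b ht hb0 fun z hz => hb z (cube_mono ht hz)

/-- If the `L`-cubes in `C_{L'}(u)` with centres off the cluster `C_A(w)` are good, and `C_{L'}(u)`
and `C_A(w)` are not resonant, then the Green function of `C_{L'}(u)` decays: in the radial
variable around `u`, every step of length `L + 1` off the cluster gains a factor `Q`. -/
theorem abs_green_le_of_cluster (hn : 1 ≤ n) (hd : 1 ≤ d) {Φ : ℕ → ℝ} {W : Site d → ℝ} {h E : ℝ}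
    {u w : Config n d} {L L' A : ℕ} {a K : ℝ} (ha : 0 ≤ a) (hK : 1 ≤ K) (hw : w ∈ cube u L')
    (hE : E ∉ spectrum ℝ (cubeHamiltonian Φ W h u L'))
    (hG : ∀ x y, |green Φ W h u L' E x y| ≤ K)
    (hEw : E ∉ spectrum ℝ (cubeHamiltonian Φ W h w A))
    (hGw : ∀ x y, |green Φ W h w A E x y| ≤ K)
    (hgood : ∀ x, ∀ r, r + (L + 1) ≤ L' → x ∈ cube u r → x ∉ cube w A →
      E ∉ spectrum ℝ (cubeHamiltonian Φ W h x L) ∧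
      ∀ v : cube x L, (v : Config n d) ∈ innerBoundary x L →
        |green Φ W h x L E ⟨x, center_mem_cube x L⟩ v| ≤ a)
    (y : cube u L') (hy : (y : Config n d) ∈ innerBoundary u L') :
    ∃ t : ℕ, L' ≤ t * (L + 1) + 2 * (A + 1) + 2 * (L + 1) ∧
      |green Φ W h u L' E ⟨u, center_mem_cube u L'⟩ y| ≤
        (griConst n d A * K * (griConst n d L * a)) ^ t * K := by
  classical
  set g : Config n d → ℝ := fun z => if hz : z ∈ cube u L' then green Φ W h u L' E ⟨z, hz⟩ y else 0
    with hgdef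
  have hg_mem : ∀ z : cube u L', g z = green Φ W h u L' E z y := fun z => by
    simp [hgdef, z.2]
  set Q := griConst n d A * K * (griConst n d L * a) with hQ
  have hL1 := one_le_griConst hn hd L
  have hA1 := one_le_griConst hn hd A
  have hQ0 : 0 ≤ Q := by positivity
  have hqQ : griConst n d L * a ≤ Q := by
    have : 1 ≤ griConst n d A * K := by nlinarith
    exact le_mul_of_one_le_left (by positivity) this
  obtain ⟨j, c, hjc⟩ := (mem_innerBoundary_iff y.2).1 hy
  have hsol : ∀ r, r + 1 ≤ L' → ∀ v ∈ cube u r,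
      ∑ z ∈ cube u L', hamiltonian Φ W h n v z * g z = E * g v := by
    intro r hr v hv
    have hv' : v ∈ cube u L' := cube_mono (by omega) hv
    have hne : (⟨v, hv'⟩ : cube u L') ≠ y := by
      rintro rfl
      have := mem_cube_iff.1 hv j c
      simp only at hjc
      omega
    have h1 := sum_mul_green Φ W h hE ⟨v, hv'⟩ y
    rw [if_neg hne, add_zero, ← hg_mem] at h1
    rw [← Finset.sum_coe_sort (cube u L')]
    simp only [hg_mem]
    exact h1
  -- a step from a good site
  have hstep_good : ∀ r b, r + (L + 1) ≤ L' → 0 ≤ b → (∀ z ∈ cube u (r + (L + 1)), |g z| ≤ b) →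
      ∀ x ∈ cube u r, x ∉ cube w A → |g x| ≤ griConst n d L * a * b := by
    intro r b hr hb0 hb x hx hxw
    obtain ⟨h1, h2⟩ := hgood x r hr hx hxw
    refine abs_le_of_solution Φ W h (cube_subset_cube hx (by omega) : cube x L ⊆ cube u L') h1
      (fun v hv => hsol (r + L) (by omega) v (mem_cube_add hx hv)) ha hb0
      ⟨x, center_mem_cube x L⟩ h2 fun z _ _ hz => hb z (mem_cube_add hx hz)
  have hex : ∃ ρ, w ∈ cube u ρ := ⟨L', hw⟩
  set ρ := Nat.find hex with hρ
  have hwρ : w ∈ cube u ρ := Nat.find_spec hex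
  have hρmin : ∀ {r}, w ∈ cube u r → ρ ≤ r := fun h => Nat.find_min' hex h
  have hρL : ρ ≤ L' := hρmin hw
  set lo := ρ + (A + 1) with hlo
  -- beyond the cluster: a bad site is first left through the boundary of the cluster
  have hstep_out : ∀ r b, lo ≤ r → r + (L + 1) ≤ L' → 0 ≤ b →
      (∀ z ∈ cube u (r + (L + 1)), |g z| ≤ b) → ∀ x ∈ cube u r, |g x| ≤ Q * b := by
    intro r b hlr hr hb0 hb x hx
    by_cases hxw : x ∈ cube w A
    · have h3 := abs_le_of_solution Φ W h
        (cube_subset_cube hwρ (by omega) : cube w A ⊆ cube u L') hEw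
        (fun v hv => hsol (ρ + A) (by omega) v (mem_cube_add hwρ hv)) (zero_le_one.trans hK)
        (b := griConst n d L * a * b) (by positivity) ⟨x, hxw⟩ (fun v _ => hGw _ v)
        fun z _ hzA hz => hstep_good r b hr hb0 hb z (cube_mono hlr (mem_cube_add hwρ hz)) hzA
      refine h3.trans (le_of_eq ?_)
      rw [hQ, griConst, griConst]
      ring
    · exact (hstep_good r b hr hb0 hb x hx hxw).trans (mul_le_mul_of_nonneg_right hqQ hb0)
  have hstep_in : ∀ r b, 0 ≤ r → r + (L + 1) ≤ ρ - (A + 1) → 0 ≤ b →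
      (∀ z ∈ cube u (r + (L + 1)), |g z| ≤ b) → ∀ x ∈ cube u r, |g x| ≤ Q * b := by
    intro r b _ hr hb0 hb x hx
    refine (hstep_good r b (by omega) hb0 hb x hx fun hxw => ?_).trans
      (mul_le_mul_of_nonneg_right hqQ hb0)
    have := hρmin (mem_cube_add hx (mem_cube_comm.1 hxw))
    omega
  have hinit : ∀ z ∈ cube u L', |g z| ≤ K := fun z hz => by
    rw [hg_mem ⟨z, hz⟩]; exact hG _ _
  set s₂ := (L' - lo) / (L + 1) with hs₂
  set s₁ := (ρ - (A + 1)) / (L + 1) with hs₁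
  have hK0 : 0 ≤ K := zero_le_one.trans hK
  have hs₁le : s₁ * (L + 1) ≤ ρ - (A + 1) := Nat.div_mul_le_self _ _
  have hs₂le : s₂ * (L + 1) ≤ L' - lo := Nat.div_mul_le_self _ _
  have hs₁lt : ρ - (A + 1) < s₁ * (L + 1) + (L + 1) := Nat.lt_div_mul_add (by omega)
  have hs₂lt : L' - lo < s₂ * (L + 1) + (L + 1) := Nat.lt_div_mul_add (by omega)
  have houter : ∀ z ∈ cube u (ρ - (A + 1)), |g z| ≤ Q ^ s₂ * K := by
    rcases le_or_gt lo L' with hle | hlt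
    · have := bound_iterate hQ0 hstep_out s₂ K (by omega) hK0 hinit
      exact fun z hz => this z (cube_mono (by omega) hz)
    · have h0 : s₂ = 0 := by rw [hs₂, Nat.sub_eq_zero_of_le hlt.le, Nat.zero_div]
      rw [h0, pow_zero, one_mul]
      exact fun z hz => hinit z (cube_mono (by omega) hz)
  have hinner := bound_iterate hQ0 hstep_in s₁ _ (by omega) (by positivity) houter u
    (center_mem_cube u 0)
  refine ⟨s₁ + s₂, ?_, ?_⟩
  · rw [add_mul]
    omega
  · rw [← hg_mem ⟨u, center_mem_cube u L'⟩, pow_add, mul_assoc]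
    exact hinner

end Deterministic

/-! ### Splitting a configuration into two groups of particles -/

section Splitting

variable {n n₁ n₂ d : ℕ}

theorem siteDist_le_iff {x y : Site d} {s : ℕ} :
    siteDist x y ≤ s ↔ ∀ a, (x a - y a).natAbs ≤ s := by
  simp [siteDist, Finset.sup_le_iff]

theorem lt_siteDist_iff {x y : Site d} {s : ℕ} :
    s < siteDist x y ↔ ∃ a, s < (x a - y a).natAbs := by
  rw [← not_le, siteDist_le_iff]
  push Not
  rfl

theorem siteDist_comm (x y : Site d) : siteDist x y = siteDist y x := by
  simp only [siteDist]
  exact Finset.sup_congr rfl fun a _ => natAbs_sub_comm _ _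

/-- The configuration of the first group of particles, for a splitting `e` of the `n` particles
into groups of `n₁` and `n₂`. -/
def leftPart (e : Fin n₁ ⊕ Fin n₂ ≃ Fin n) (x : Config n d) : Config n₁ d :=
  fun i => x (e (Sum.inl i))

/-- The configuration of the second group of particles. -/
def rightPart (e : Fin n₁ ⊕ Fin n₂ ≃ Fin n) (x : Config n d) : Config n₂ d :=
  fun i => x (e (Sum.inr i))

/-- The two groups of particles do not interact in the configuration `x`. -/
def NonInteracting (Φ : ℕ → ℝ) (e : Fin n₁ ⊕ Fin n₂ ≃ Fin n) (x : Config n d) : Prop :=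
  ∀ i j, Φ (siteDist (x (e (Sum.inl i))) (x (e (Sum.inr j)))) = 0

theorem two_mul_interaction (Φ : ℕ → ℝ) (x : Config n d) :
    2 * interaction d Φ n x = ∑ i, ∑ j, if i ≠ j then Φ (siteDist (x i) (x j)) else 0 := by
  have h1 : interaction d Φ n x = ∑ i, ∑ j, if j < i then Φ (siteDist (x i) (x j)) else 0 := by
    rw [interaction, Finset.sum_comm]
    exact Finset.sum_congr rfl fun i _ => Finset.sum_congr rfl fun j _ => by
      rw [siteDist_comm]
  rw [two_mul]
  nth_rewrite 1 [interaction]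
  rw [h1, ← Finset.sum_add_distrib]
  refine Finset.sum_congr rfl fun i _ => ?_
  rw [← Finset.sum_add_distrib]
  refine Finset.sum_congr rfl fun j _ => ?_
  rcases lt_trichotomy i j with h | h | h
  · simp [h, h.ne, not_lt.2 h.le]
  · simp [h]
  · simp [h, h.ne', not_lt.2 h.le]

theorem interaction_split {Φ : ℕ → ℝ} {e : Fin n₁ ⊕ Fin n₂ ≃ Fin n} {x : Config n d}
    (hx : NonInteracting Φ e x) :
    interaction d Φ n x =
      interaction d Φ n₁ (leftPart e x) + interaction d Φ n₂ (rightPart e x) := by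
  have hx' : ∀ i j, Φ (siteDist (x (e (Sum.inr j))) (x (e (Sum.inl i)))) = 0 := fun i j => by
    rw [siteDist_comm]; exact hx i j
  have key : 2 * interaction d Φ n x =
      2 * interaction d Φ n₁ (leftPart e x) + 2 * interaction d Φ n₂ (rightPart e x) := by
    rw [two_mul_interaction, two_mul_interaction, two_mul_interaction, ← e.sum_comp]
    simp only [← e.sum_comp (fun j => ite _ _ _), Fintype.sum_sum_type]
    simp only [ne_eq, EmbeddingLike.apply_eq_iff_eq, Sum.inl.injEq, Sum.inr.injEq, reduceCtorEq,
      not_false_eq_true, if_true, hx _ _, hx' _ _, Finset.sum_const_zero, add_zero, zero_add]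
    rfl
  linarith

theorem l1Dist_split (e : Fin n₁ ⊕ Fin n₂ ≃ Fin n) (x y : Config n d) :
    l1Dist x y = l1Dist (leftPart e x) (leftPart e y) + l1Dist (rightPart e x) (rightPart e y) := by
  simp only [l1Dist]
  rw [← e.sum_comp, Fintype.sum_sum_type]
  rfl

theorem leftPart_rightPart_ext (e : Fin n₁ ⊕ Fin n₂ ≃ Fin n) {x y : Config n d}
    (h1 : leftPart e x = leftPart e y) (h2 : rightPart e x = rightPart e y) : x = y := by
  funext j
  obtain ⟨i, rfl⟩ := e.surjective j
  cases i with
  | inl i => exact congrFun h1 i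
  | inr i => exact congrFun h2 i

theorem leftPart_mem_cube {e : Fin n₁ ⊕ Fin n₂ ≃ Fin n} {u x : Config n d} {L : ℕ}
    (hx : x ∈ cube u L) : leftPart e x ∈ cube (leftPart e u) L :=
  mem_cube_iff.2 fun _ a => mem_cube_iff.1 hx _ a

theorem rightPart_mem_cube {e : Fin n₁ ⊕ Fin n₂ ≃ Fin n} {u x : Config n d} {L : ℕ}
    (hx : x ∈ cube u L) : rightPart e x ∈ cube (rightPart e u) L :=
  mem_cube_iff.2 fun _ a => mem_cube_iff.1 hx _ a

/-- Put two groups of particles together. -/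
def joinParts (e : Fin n₁ ⊕ Fin n₂ ≃ Fin n) (x₁ : Config n₁ d) (x₂ : Config n₂ d) : Config n d :=
  fun j => Sum.elim x₁ x₂ (e.symm j)

theorem leftPart_joinParts (e : Fin n₁ ⊕ Fin n₂ ≃ Fin n) (x₁ : Config n₁ d) (x₂ : Config n₂ d) :
    leftPart e (joinParts e x₁ x₂) = x₁ := by
  funext i
  simp [leftPart, joinParts]

theorem rightPart_joinParts (e : Fin n₁ ⊕ Fin n₂ ≃ Fin n) (x₁ : Config n₁ d)
    (x₂ : Config n₂ d) : rightPart e (joinParts e x₁ x₂) = x₂ := by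
  funext i
  simp [rightPart, joinParts]

/-- A cube of `n` particles is the product of its projections. -/
def cubeEquivProd (e : Fin n₁ ⊕ Fin n₂ ≃ Fin n) (u : Config n d) (L : ℕ) :
    cube u L ≃ cube (leftPart e u) L × cube (rightPart e u) L where
  toFun x := (⟨leftPart e x, leftPart_mem_cube x.2⟩, ⟨rightPart e x, rightPart_mem_cube x.2⟩)
  invFun q := ⟨joinParts e q.1 q.2, mem_cube_iff.2 fun j a => by
    obtain ⟨i, rfl⟩ := e.surjective j
    cases i with
    | inl i => simpa [joinParts, leftPart] using mem_cube_iff.1 q.1.2 i a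
    | inr i => simpa [joinParts, rightPart] using mem_cube_iff.1 q.2.2 i a⟩
  left_inv x := Subtype.ext <| leftPart_rightPart_ext e
    (leftPart_joinParts _ _ _) (rightPart_joinParts _ _ _)
  right_inv q := Prod.ext (Subtype.ext (leftPart_joinParts _ _ _))
    (Subtype.ext (rightPart_joinParts _ _ _))

/-- The Hamiltonian of two groups of particles that do not interact is a Kronecker sum. -/
theorem cubeHamiltonian_eq_kroneckerSum {Φ : ℕ → ℝ} {W : Site d → ℝ} {h : ℝ}
    {e : Fin n₁ ⊕ Fin n₂ ≃ Fin n} {u : Config n d} {L : ℕ}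
    (hu : ∀ x ∈ cube u L, NonInteracting Φ e x) :
    cubeHamiltonian Φ W h u L =
      (cubeHamiltonian Φ W h (leftPart e u) L ⊗ₖ
          (1 : Matrix (cube (rightPart e u) L) (cube (rightPart e u) L) ℝ) +
        (1 : Matrix (cube (leftPart e u) L) (cube (leftPart e u) L) ℝ) ⊗ₖ
          cubeHamiltonian Φ W h (rightPart e u) L).submatrix
        (cubeEquivProd e u L) (cubeEquivProd e u L) := by
  have hn : (n : ℝ) = n₁ + n₂ := by
    have : n = n₁ + n₂ := by simpa using (Fintype.card_congr e).symm
    exact_mod_cast this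
  ext x y
  simp only [submatrix_apply, Matrix.add_apply, kroneckerMap_apply, cubeHamiltonian,
    cubeEquivProd, Equiv.coe_fn_mk, one_apply, Subtype.mk.injEq]
  by_cases h1 : leftPart e x.1 = leftPart e y.1
  · by_cases h2 : rightPart e x.1 = rightPart e y.1
    · rw [← leftPart_rightPart_ext e h1 h2]
      simp only [if_true, mul_one, one_mul, hamiltonian_apply_self]
      rw [interaction_split (hu x x.2), ← e.sum_comp, Fintype.sum_sum_type, hn]
      simp only [leftPart, rightPart]
      ring
    · have hne : (x : Config n d) ≠ y := fun h0 => h2 (by rw [h0])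
      rw [if_neg h2, if_pos h1, mul_zero, zero_add, one_mul, hamiltonian_apply_ne _ _ _ hne,
        hamiltonian_apply_ne _ _ _ h2, l1Dist_split e, l1Dist_eq_zero.2 h1, zero_add]
  · have hne : (x : Config n d) ≠ y := fun h0 => h1 (by rw [h0])
    rw [if_neg h1, zero_mul, add_zero, hamiltonian_apply_ne _ _ _ hne, l1Dist_split e]
    by_cases h2 : rightPart e x.1 = rightPart e y.1
    · rw [if_pos h2, l1Dist_eq_zero.2 h2, add_zero, mul_one, hamiltonian_apply_ne _ _ _ h1]
    · rw [if_neg h2, mul_zero, if_neg]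
      have := mt l1Dist_eq_zero.1 h1
      have := mt l1Dist_eq_zero.1 h2
      omega

theorem decayRate_anti {N : ℕ} {m : ℝ} (hm : 0 ≤ m) (L : ℕ) {n₁ n : ℕ} (h : n₁ ≤ n) :
    decayRate N m L n ≤ decayRate N m L n₁ := by
  unfold decayRate
  gcongr
  exact le_add_of_nonneg_right (by positivity)

/-- Decay of the Green function at the part of the boundary where a particle of the first group
has moved by `L`. -/
theorem green_decay_of_leftPart {N : ℕ} {Φ : ℕ → ℝ} {W : Site d → ℝ} {E m h : ℝ} (hm : 0 ≤ m)
    {e : Fin n₁ ⊕ Fin n₂ ≃ Fin n} {u : Config n d} {L : ℕ}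
    (hu : ∀ x ∈ cube u L, NonInteracting Φ e x)
    (hns : ∀ i, IsNonsingular N Φ W (E - cubeEigenvalue Φ h (rightPart e u) L i W) m h
      (leftPart e u) L) :
    E ∉ spectrum ℝ (cubeHamiltonian Φ W h u L) ∧
      ∀ v : cube u L, leftPart e v.1 ∈ innerBoundary (leftPart e u) L →
        |green Φ W h u L E ⟨u, center_mem_cube u L⟩ v| ≤ Real.exp (-(decayRate N m L n * L)) := by
  have hn : n = n₁ + n₂ := by simpa using (Fintype.card_congr e).symm
  obtain ⟨h1, h2⟩ := abs_resolvent_kroneckerSum_le (cubeHamiltonian Φ W h (leftPart e u) L)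
    (isHermitian_cubeHamiltonian Φ W h (rightPart e u) L)
    (b := Real.exp (-(decayRate N m L n * L))) (fun i => (hns i).1)
  rw [green, cubeHamiltonian_eq_kroneckerSum hu]
  set A := cubeHamiltonian Φ W h (leftPart e u) L ⊗ₖ
          (1 : Matrix (cube (rightPart e u) L) (cube (rightPart e u) L) ℝ) +
        (1 : Matrix (cube (leftPart e u) L) (cube (leftPart e u) L) ℝ) ⊗ₖ
          cubeHamiltonian Φ W h (rightPart e u) L with hA
  have hsub : A.submatrix (cubeEquivProd e u L) (cubeEquivProd e u L) - E • 1 =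
      (A - E • 1).submatrix (cubeEquivProd e u L) (cubeEquivProd e u L) := by
    ext x y
    simp [one_apply]
  constructor
  · rw [spectrum.notMem_iff, Algebra.algebraMap_eq_smul_one, ← neg_sub, IsUnit.neg_iff,
      isUnit_iff_isUnit_det, hsub, det_submatrix_equiv_self]
    exact isUnit_sub_of_notMem_spectrum h1
  · intro v hv
    rw [hsub, inv_submatrix_equiv, submatrix_apply]
    refine h2 _ _ fun i => ((hns i).2 ⟨leftPart e v.1, leftPart_mem_cube v.2⟩ hv).trans ?_
    rw [Real.exp_le_exp, neg_le_neg_iff]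
    exact mul_le_mul_of_nonneg_right (decayRate_anti hm L (by omega)) (Nat.cast_nonneg L)

/-- A cube in which two groups of particles do not interact is nonsingular at `E` if its two
projections are nonsingular at all energies `E - λ`, where `λ` is an eigenvalue of the other. -/
theorem isNonsingular_of_split {N : ℕ} {Φ : ℕ → ℝ} {W : Site d → ℝ} {E m h : ℝ} (hm : 0 ≤ m)
    {e : Fin n₁ ⊕ Fin n₂ ≃ Fin n} {u : Config n d} {L : ℕ}
    (hu : ∀ x ∈ cube u L, NonInteracting Φ e x)
    (h1 : ∀ i, IsNonsingular N Φ W (E - cubeEigenvalue Φ h (rightPart e u) L i W) m h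
      (leftPart e u) L)
    (h2 : ∀ i, IsNonsingular N Φ W (E - cubeEigenvalue Φ h (leftPart e u) L i W) m h
      (rightPart e u) L) :
    IsNonsingular N Φ W E m h u L := by
  obtain ⟨ha, hb⟩ := green_decay_of_leftPart hm hu h1
  obtain ⟨-, hc⟩ := green_decay_of_leftPart (e := (Equiv.sumComm _ _).trans e) hm
    (fun x hx i j => by rw [siteDist_comm]; exact hu x hx j i) h2
  refine ⟨ha, fun v hv => ?_⟩
  obtain ⟨j, a, hja⟩ := (mem_innerBoundary_iff v.2).1 hv
  obtain ⟨i, rfl⟩ := e.surjective j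
  cases i with
  | inl i => exact hb v ((mem_innerBoundary_iff (leftPart_mem_cube v.2)).2 ⟨i, a, hja⟩)
  | inr i => exact hc v ((mem_innerBoundary_iff (rightPart_mem_cube v.2)).2 ⟨i, a, hja⟩)

end Splitting

/-! ### Energies outside the interval `I` -/

section OutsideEnergies

variable {n d : ℕ}

theorem bddAbove_abs_interaction {Φ : ℕ → ℝ} {r₀ : ℕ} (hΦ : Function.support Φ ⊆ Set.Icc 0 r₀)
    (N : ℕ) : BddAbove (Set.range fun x : Config N d => |interaction d Φ N x|) := by
  have hb : ∀ s, |Φ s| ≤ ∑ t ∈ Finset.range (r₀ + 1), |Φ t| := fun s => by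
    by_cases hs : s ≤ r₀
    · exact Finset.single_le_sum (f := fun t => |Φ t|) (fun _ _ => abs_nonneg _)
        (Finset.mem_range.2 (by omega))
    · have : Φ s = 0 := by
        by_contra h0
        exact hs (hΦ (Function.mem_support.2 h0)).2
      rw [this, abs_zero]
      exact Finset.sum_nonneg fun _ _ => abs_nonneg _
  refine ⟨∑ _i : Fin N, ∑ _j : Fin N, ∑ t ∈ Finset.range (r₀ + 1), |Φ t|, ?_⟩
  rintro _ ⟨x, rfl⟩
  refine (Finset.abs_sum_le_sum_abs _ _).trans (Finset.sum_le_sum fun i _ => ?_)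
  refine (Finset.abs_sum_le_sum_abs _ _).trans (Finset.sum_le_sum fun j _ => ?_)
  split_ifs
  · exact hb _
  · rw [abs_zero]
    exact Finset.sum_nonneg fun _ _ => abs_nonneg _

/-- Removing particles does not increase the supremum norm of the interaction: additional particles
can be placed far away from each other and from the given ones. -/
theorem abs_interaction_le_interactionNorm (hd : 1 ≤ d) {Φ : ℕ → ℝ} {r₀ : ℕ}
    (hΦ : Function.support Φ ⊆ Set.Icc 0 r₀) {N : ℕ} (hn : n ≤ N) (x : Config n d) :
    |interaction d Φ n x| ≤ interactionNorm d Φ N := by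
  obtain ⟨k, rfl⟩ := Nat.exists_eq_add_of_le hn
  have hzero : ∀ s, r₀ < s → Φ s = 0 := fun s hs => by
    by_contra h0
    exact absurd (hΦ (Function.mem_support.2 h0)).2 (not_le.2 hs)
  set R : ℕ := ∑ i, (x i ⟨0, hd⟩).natAbs with hR
  have hxR : ∀ i, (x i ⟨0, hd⟩).natAbs ≤ R := fun i =>
    Finset.single_le_sum (f := fun i => (x i ⟨0, hd⟩).natAbs) (fun _ _ => Nat.zero_le _)
      (Finset.mem_univ i)
  set y : Config k d := fun j _ => R + (r₀ + 1) * ((j : ℕ) + 1) with hy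
  set e : Fin n ⊕ Fin k ≃ Fin (n + k) := finSumFinEquiv with he
  have hni : NonInteracting Φ e (joinParts e x y) := fun i j => by
    apply hzero
    rw [lt_siteDist_iff]
    refine ⟨⟨0, hd⟩, ?_⟩
    simp only [joinParts, Equiv.symm_apply_apply, Sum.elim_inl, Sum.elim_inr, hy]
    have h1 := hxR i
    have h2 : (r₀ + 1 : ℤ) ≤ (r₀ + 1) * ((j : ℕ) + 1) := by nlinarith [(j : ℕ).zero_le]
    omega
  have hy0 : interaction d Φ k y = 0 := by
    refine Finset.sum_eq_zero fun i _ => Finset.sum_eq_zero fun j _ => ?_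
    split_ifs with hij
    · apply hzero
      rw [lt_siteDist_iff]
      refine ⟨⟨0, hd⟩, ?_⟩
      simp only [hy]
      have h1 : ((i : ℕ) : ℤ) + 1 ≤ (j : ℕ) := by exact_mod_cast hij
      have h2 : (r₀ + 1 : ℤ) * ((i : ℕ) + 1) + (r₀ + 1) ≤ (r₀ + 1) * ((j : ℕ) + 1) := by nlinarith
      omega
    · rfl
  have hsplit := interaction_split hni
  rw [leftPart_joinParts, rightPart_joinParts, hy0, add_zero] at hsplit
  rw [← hsplit]
  exact le_ciSup (bddAbove_abs_interaction hΦ (n + k)) _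

/-- If `E` is at distance at least `κ + 1`, `κ ≥ 2nd`, from the diagonal of the Hamiltonian, then
the maximum principle gives exponential decay of the Green function, with the rate
`log ((κ + 1) / κ)`. -/
theorem green_decay_of_dominant {Φ : ℕ → ℝ} {W : Site d → ℝ} {h E κ : ℝ} {u : Config n d}
    {L : ℕ} (hκ : 2 * n * d ≤ κ) (hE : ∀ x ∈ cube u L, κ + 1 ≤ |hamiltonian Φ W h n x x - E|) :
    E ∉ spectrum ℝ (cubeHamiltonian Φ W h u L) ∧
      ∀ v : cube u L, (v : Config n d) ∈ innerBoundary u L →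
        |green Φ W h u L E ⟨u, center_mem_cube u L⟩ v| ≤ (κ / (κ + 1)) ^ L := by
  have hκ0 : 0 ≤ κ := le_trans (by positivity) hκ
  have hspec : E ∉ spectrum ℝ (cubeHamiltonian Φ W h u L) := by
    rw [spectrum.notMem_iff, Algebra.algebraMap_eq_smul_one, ← neg_sub, IsUnit.neg_iff,
      isUnit_iff_isUnit_det, isUnit_iff_ne_zero]
    refine det_ne_zero_of_sum_row_lt_diag fun x => ?_
    have h1 := sum_offDiag_le Φ W h (Finset.notMem_erase x.1 (cube u L)) (g := fun _ => -1)
      zero_le_one (fun _ _ _ => by simp)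
    have h2 : ∑ z ∈ (cube u L).erase x, hamiltonian Φ W h n x z * (-1) =
        ∑ z ∈ Finset.univ.erase x, ‖(cubeHamiltonian Φ W h u L - E • 1) x z‖ := by
      refine (Finset.sum_bij (fun (z : cube u L) _ => z.1) (fun z hz => ?_)
        (fun _ _ _ _ h0 => Subtype.ext h0) (fun z hz => ?_) fun z hz => ?_).symm
      · exact Finset.mem_erase.2 ⟨Subtype.coe_ne_coe.2 (Finset.ne_of_mem_erase hz), z.2⟩
      · exact ⟨⟨z, Finset.mem_of_mem_erase hz⟩, Finset.mem_erase.2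
          ⟨fun h0 => Finset.ne_of_mem_erase hz (congrArg Subtype.val h0), Finset.mem_univ _⟩, rfl⟩
      · have hne : x ≠ z := (Finset.ne_of_mem_erase hz).symm
        simp only [Matrix.sub_apply, Matrix.smul_apply, one_apply_ne hne, smul_zero, sub_zero,
          cubeHamiltonian, submatrix_apply, hamiltonian_apply_ne _ _ _ (Subtype.coe_ne_coe.2 hne)]
        split_ifs <;> simp
    rw [← h2]
    have h3 := hE x x.2
    calc _ ≤ _ := le_abs_self _
      _ ≤ _ := h1
      _ < κ + 1 := by linarith
      _ ≤ _ := h3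
      _ = _ := by simp [cubeHamiltonian]
  refine ⟨hspec, fun y hy => ?_⟩
  classical
  set g : Config n d → ℝ := fun z => if hz : z ∈ cube u L then green Φ W h u L E ⟨z, hz⟩ y else 0
    with hgdef
  have hg_mem : ∀ z : cube u L, g z = green Φ W h u L E z y := fun z => by
    simp [hgdef, z.2]
  have hrow : ∀ (x : cube u L) (b : ℝ), 0 ≤ b →
      (∀ z ∈ cube u L, l1Dist x.1 z = 1 → |g z| ≤ b) →
      (κ + 1) * |g x| ≤ κ * b + if x = y then 1 else 0 := by
    intro x b hb0 hb
    have h1 := sum_mul_green Φ W h hspec x y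
    simp only [← hg_mem] at h1
    rw [Finset.sum_coe_sort (cube u L) (fun z => hamiltonian Φ W h n x z * g z),
      ← Finset.add_sum_erase _ _ x.2] at h1
    have h2 := sum_offDiag_le Φ W h (Finset.notMem_erase x.1 (cube u L)) hb0
      (fun z hz => hb z (Finset.mem_of_mem_erase hz))
    have h3 : (hamiltonian Φ W h n x x - E) * g x = (if x = y then 1 else 0) -
        ∑ z ∈ (cube u L).erase x, hamiltonian Φ W h n x z * g z := by linarith
    have h4 : |hamiltonian Φ W h n x x - E| * |g x| ≤
        (if x = y then 1 else 0) + 2 * n * d * b := by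
      rw [← abs_mul, h3]
      refine (abs_sub _ _).trans (add_le_add ?_ h2)
      split_ifs <;> simp
    nlinarith [mul_le_mul_of_nonneg_right (hE x x.2) (abs_nonneg (g x)),
      mul_le_mul_of_nonneg_right hκ hb0]
  obtain ⟨x₀, -, hx₀⟩ := Finset.exists_max_image Finset.univ (fun x : cube u L => |g x|)
    ⟨⟨u, center_mem_cube u L⟩, Finset.mem_univ _⟩
  have hle_one : ∀ z ∈ cube u L, |g z| ≤ 1 := by
    have h1 := hrow x₀ |g x₀| (abs_nonneg _) fun z hz _ => hx₀ ⟨z, hz⟩ (Finset.mem_univ _)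
    intro z hz
    refine (hx₀ ⟨z, hz⟩ (Finset.mem_univ _)).trans ?_
    split_ifs at h1 <;> linarith
  obtain ⟨j, c, hjc⟩ := (mem_innerBoundary_iff y.2).1 hy
  have := bound_iterate (u := u) (g := g) (Q := κ / (κ + 1)) (by positivity) (s := 1) (lo := 0)
    (hi := L) (fun r b _ hr hb0 hb x hx => by
      have hxL : x ∈ cube u L := cube_mono (by omega) hx
      have hne : (⟨x, hxL⟩ : cube u L) ≠ y := by
        rintro rfl
        have := mem_cube_iff.1 hx j c
        simp only at hjc
        omega
      have h1 := hrow ⟨x, hxL⟩ b hb0 fun z _ h1 => hb z (mem_cube_add hx (mem_cube_iff.2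
        fun j a => by
          rw [natAbs_sub_comm]
          exact (natAbs_le_l1Dist x z j a).trans h1.le))
      rw [if_neg hne, add_zero] at h1
      rw [div_mul_eq_mul_div, le_div_iff₀ (by positivity), mul_comm]
      exact h1) L 1 (by omega) zero_le_one hle_one u (center_mem_cube u 0)
  rw [← hg_mem ⟨u, center_mem_cube u L⟩]
  simpa using this

theorem decayRate_le {N : ℕ} {m : ℝ} (hm : 0 ≤ m) {L n : ℕ} (hL : 1 ≤ L) (hn : 1 ≤ n)
    (hN : 1 ≤ N) : decayRate N m L n ≤ m * 2 ^ N := by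
  unfold decayRate
  have h1 : (L : ℝ) ^ (-(1 / 8 : ℝ)) ≤ 1 :=
    Real.rpow_le_one_of_one_le_of_nonpos (by exact_mod_cast hL) (by norm_num)
  have h2 : 0 ≤ (L : ℝ) ^ (-(1 / 8 : ℝ)) := by positivity
  gcongr m * ?_
  calc (1 + (L : ℝ) ^ (-(1 / 8 : ℝ))) ^ (N - n + 1) ≤ 2 ^ (N - n + 1) := by
        gcongr; linarith
    _ ≤ 2 ^ N := pow_le_pow_right₀ (by norm_num) (by omega)

/-- At an energy outside `I`, which is at a distance greater than `1` from the spectra, all cubes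
are nonsingular. -/
theorem isNonsingular_of_notMem_energyInterval {N : ℕ} (hN : 1 ≤ N) (hd : 1 ≤ d) {Φ : ℕ → ℝ}
    {r₀ : ℕ} (hΦ : Function.support Φ ⊆ Set.Icc 0 r₀) {M m h E : ℝ} (hM : 0 ≤ M) (hm : 0 ≤ m)
    (hm' : m ≤ 1 / (2 ^ (N + 1) * (12 * N * d))) (hn1 : 1 ≤ n) (hn : n ≤ N) {W : Site d → ℝ}
    (hW : ∀ s, |W s| ≤ M) {L : ℕ} (hL : 1 ≤ L) (hE : E ∉ energyInterval N d Φ M h)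
    (u : Config n d) : IsNonsingular N Φ W E m h u L := by
  have hN' : (1 : ℝ) ≤ N := by exact_mod_cast hN
  have hd' : (1 : ℝ) ≤ d := by exact_mod_cast hd
  have hn' : (n : ℝ) ≤ N := by exact_mod_cast hn
  have hNd : 1 ≤ (N : ℝ) * d := by nlinarith
  have hnd : (n : ℝ) * d ≤ N * d := by nlinarith
  have hnM : (n : ℝ) * M ≤ N * M := by nlinarith
  set κ : ℝ := 2 * N * d with hκ
  have hκ0 : 0 ≤ κ := by positivity
  obtain ⟨h1, h2⟩ := green_decay_of_dominant (Φ := Φ) (W := W) (h := h) (E := E) (κ := κ) (u := u)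
    (L := L) (by rw [hκ]; nlinarith) (fun x _ => by
      have hsum : |∑ j, W (x j)| ≤ n * M := by
        refine (Finset.abs_sum_le_sum_abs _ _).trans ?_
        simpa using Finset.sum_le_sum fun j (_ : j ∈ Finset.univ) => hW (x j)
      have hint : |h * interaction d Φ n x| ≤ |h| * interactionNorm d Φ N := by
        rw [abs_mul]
        exact mul_le_mul_of_nonneg_left (abs_interaction_le_interactionNorm hd hΦ hn x)
          (abs_nonneg h)
      rw [hamiltonian_apply_self, le_abs]
      rw [abs_le] at hsum hint
      have hnd0 : 0 ≤ (n : ℝ) * d := by positivity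
      simp only [energyInterval, Set.mem_Icc, not_and_or, not_le] at hE
      rcases hE with hE | hE
      · left; nlinarith
      · right; nlinarith)
  refine ⟨h1, fun v hv => (h2 v hv).trans ?_⟩
  have hγ : decayRate N m L n ≤ 1 / (κ + 1) := by
    refine (decayRate_le hm hL hn1 hN).trans ?_
    calc m * 2 ^ N ≤ 1 / (2 ^ (N + 1) * (12 * N * d)) * 2 ^ N := by gcongr
      _ = 1 / (24 * (N * d)) := by
        rw [pow_succ]
        field_simp
        norm_num
      _ ≤ 1 / (κ + 1) := by
        apply one_div_le_one_div_of_le (by positivity)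
        rw [hκ]; nlinarith
  have hexp : κ / (κ + 1) ≤ Real.exp (-decayRate N m L n) := by
    have h3 := Real.add_one_le_exp (-decayRate N m L n)
    have h4 : κ / (κ + 1) = 1 - 1 / (κ + 1) := by field_simp; ring
    linarith
  calc (κ / (κ + 1)) ^ L ≤ Real.exp (-decayRate N m L n) ^ L := by gcongr
    _ = Real.exp (-(decayRate N m L n * L)) := by
      rw [← Real.exp_nat_mul]
      congr 1
      ring

end OutsideEnergies

/-! ### Partially interactive cubes -/

section PartiallyInteractive

variable {n d : ℕ}

/-- The cube `C_L(u)` is partially interactive: the particles split into two groups, at distances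
greater than `2 L + r₀` from each other at the centre `u`. -/
def IsPartiallyInteractive (r₀ : ℕ) (u : Config n d) (L : ℕ) : Prop :=
  ∃ (n₁ n₂ : ℕ) (e : Fin n₁ ⊕ Fin n₂ ≃ Fin n), 1 ≤ n₁ ∧ 1 ≤ n₂ ∧
    ∀ i j, 2 * L + r₀ < siteDist (u (e (Sum.inl i))) (u (e (Sum.inr j)))

variable {Ω : Type*} [MeasurableSpace Ω] {P : Measure Ω} {V : Site d → Ω → ℝ} {μ : Measure ℝ}

theorem IsIIDField.ae_abs_le (hV : IsIIDField P V μ) {M : ℝ} (hμ : IsAdmissibleLaw μ M) :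
    ∀ᵐ ω ∂P, ∀ s, |V s ω| ≤ M := by
  refine ae_all_iff.2 fun s => ?_
  have h1 : P.map (V s) (Set.Icc (-M) M)ᶜ = 0 := by rw [hV.law s]; exact hμ.supported
  rw [Measure.map_apply (hV.measurable s) measurableSet_Icc.compl] at h1
  refine measure_mono_null (fun ω hω => ?_) h1
  intro h2
  exact hω (abs_le.2 h2)

/-- With small probability a cube is singular at `E - λ` for some eigenvalue `λ` of another cube
that sees a disjoint part of the potential. By independence `λ` may be treated as fixed, and almost
surely singularity does not occur when `E - λ` is outside `I`. -/
theorem measure_singular_at_shifted_energy_le [IsProbabilityMeasure P] (hV : IsIIDField P V μ)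
    {M : ℝ} (hμ : IsAdmissibleLaw μ M) {N : ℕ} (hN : 1 ≤ N) (hd : 1 ≤ d) {Φ : ℕ → ℝ} {r₀ : ℕ}
    (hΦ : Function.support Φ ⊆ Set.Icc 0 r₀) {m h : ℝ} (hm : 0 ≤ m)
    (hm' : m ≤ 1 / (2 ^ (N + 1) * (12 * N * d))) {n₁ n₂ : ℕ} (hn1 : 1 ≤ n₁) (hn : n₁ ≤ N) {L : ℕ}
    (hL : 1 ≤ L) {q : ℝ} {u₁ : Config n₁ d} {u₂ : Config n₂ d}
    (hq : ∀ E ∈ energyInterval N d Φ M h,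
      P.real {ω | IsSingular N Φ (fun s => V s ω) E m h u₁ L} ≤ q)
    (hdisj : Disjoint (siteSet u₁ L) (siteSet u₂ L)) (E : ℝ) :
    P {ω | ∃ i, IsSingular N Φ (fun s => V s ω)
        (E - cubeEigenvalue Φ h u₂ L i (fun s => V s ω)) m h u₁ L} ≤
      (cube u₂ L).card * ENNReal.ofReal q := by
  have hone : ∀ i, P {ω | IsSingular N Φ (fun s => V s ω)
        (E - cubeEigenvalue Φ h u₂ L i (fun s => V s ω)) m h u₁ L} ≤ ENNReal.ofReal q := by
    intro i
    set A : Set ((siteSet u₁ L → ℝ) × (siteSet u₂ L → ℝ)) :=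
      {p | IsSingular N Φ (extendZero p.1)
        (E - cubeEigenvalue Φ h u₂ L i (extendZero p.2)) m h u₁ L} with hA
    have hAm : MeasurableSet A := by
      have h1 : Measurable fun p : (siteSet u₁ L → ℝ) × (siteSet u₂ L → ℝ) =>
          (p.1, E - cubeEigenvalue Φ h u₂ L i (extendZero p.2)) :=
        measurable_fst.prodMk (measurable_const.sub
          ((continuous_cubeEigenvalue_extendZero i _).measurable.comp measurable_snd))
      exact h1 (measurableSet_isSingular (siteSet u₁ L))
    have h2 := measure_le_of_forall_section_le (hV.measurable_restrict (siteSet u₁ L))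
      (hV.measurable_restrict (siteSet u₂ L)) (hV.indepFun_restrict hdisj) hAm
      (c := ENNReal.ofReal q) (fun y => by
        set E' := E - cubeEigenvalue Φ h u₂ L i (extendZero y)
        have hset : {ω | ((fun s : siteSet u₁ L => V s ω), y) ∈ A} =
            {ω | IsSingular N Φ (fun s => V s ω) E' m h u₁ L} := by
          ext ω
          exact isSingular_congr (cubeHamiltonian_restrict Φ (fun s => V s ω) h u₁ L)
        rw [hset]
        by_cases hE' : E' ∈ energyInterval N d Φ M h
        · rw [← ofReal_measureReal]
          exact ENNReal.ofReal_le_ofReal (hq E' hE')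
        · have : P {ω | IsSingular N Φ (fun s => V s ω) E' m h u₁ L} = 0 := by
            have hae := hV.ae_abs_le hμ
            rw [ae_iff] at hae
            refine measure_mono_null (fun ω hω => ?_) hae
            rw [Set.mem_ofPred_eq]
            intro hb
            exact hω (isNonsingular_of_notMem_energyInterval hN hd hΦ hμ.bound_pos.le hm hm' hn1
              hn hb hL hE' u₁)
          rw [this]
          exact zero_le)
    refine le_of_eq_of_le (congrArg P ?_) h2
    ext ω
    have h3 : cubeEigenvalue Φ h u₂ L i (extendZero fun s : siteSet u₂ L => V s ω) =
        cubeEigenvalue Φ h u₂ L i (fun s => V s ω) :=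
      cubeEigenvalue_congr i fun s hs => extendZero_apply _ hs
    simp only [hA, Set.mem_ofPred_eq, h3]
    exact (isSingular_congr (cubeHamiltonian_restrict Φ (fun s => V s ω) h u₁ L)).symm
  rw [Set.ofPred_exists]
  refine (measure_iUnion_fintype_le _ _).trans ((Finset.sum_le_sum fun i _ => hone i).trans ?_)
  rw [Finset.sum_const, nsmul_eq_mul, Finset.card_univ, Fintype.card_coe]

theorem disjoint_siteSet_of_siteDist {n₁ n₂ : ℕ} {u₁ : Config n₁ d} {u₂ : Config n₂ d} {L : ℕ}
    (h : ∀ i j, 2 * L < siteDist (u₁ i) (u₂ j)) : Disjoint (siteSet u₁ L) (siteSet u₂ L) := by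
  rw [Finset.disjoint_left]
  intro s h1 h2
  obtain ⟨i, hi⟩ := exists_of_mem_siteSet h1
  obtain ⟨j, hj⟩ := exists_of_mem_siteSet h2
  obtain ⟨a, ha⟩ := lt_siteDist_iff.1 (h i j)
  have := hi a
  have := hj a
  omega

/-- A partially interactive cube is singular with small probability, if this holds for the cubes
with fewer particles. -/
theorem measureReal_singular_le_of_isPartiallyInteractive [IsProbabilityMeasure P]
    (hV : IsIIDField P V μ)
    {M : ℝ} (hμ : IsAdmissibleLaw μ M) {N : ℕ} (hN : 1 ≤ N) (hd : 1 ≤ d) {Φ : ℕ → ℝ} {r₀ : ℕ}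
    (hΦ : Function.support Φ ⊆ Set.Icc 0 r₀) {m h : ℝ} (hm : 0 ≤ m)
    (hm' : m ≤ 1 / (2 ^ (N + 1) * (12 * N * d))) (hn : n ≤ N) {L : ℕ}
    (hL : 1 ≤ L) {q : ℝ} (hq0 : 0 ≤ q)
    (hq : ∀ n', 1 ≤ n' → n' < n → ∀ E ∈ energyInterval N d Φ M h, ∀ u' : Config n' d,
      P.real {ω | IsSingular N Φ (fun s => V s ω) E m h u' L} ≤ q)
    {u : Config n d} (hu : IsPartiallyInteractive r₀ u L) (E : ℝ) :
    P.real {ω | IsSingular N Φ (fun s => V s ω) E m h u L} ≤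
      2 * (2 * L + 1 : ℝ) ^ (n * d) * q := by
  obtain ⟨n₁, n₂, e, hn₁, hn₂, hsep⟩ := hu
  have hnn : n = n₁ + n₂ := by simpa using (Fintype.card_congr e).symm
  have hni : ∀ x ∈ cube u L, NonInteracting Φ e x := by
    intro x hx i j
    by_contra h0
    have h1 := (hΦ (Function.mem_support.2 h0)).2
    obtain ⟨a, ha⟩ := lt_siteDist_iff.1 (hsep i j)
    have h2 := siteDist_le_iff.1 h1 a
    have h3 := mem_cube_iff.1 hx (e (Sum.inl i)) a
    have h4 := mem_cube_iff.1 hx (e (Sum.inr j)) a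
    omega
  have hdisj : Disjoint (siteSet (leftPart e u) L) (siteSet (rightPart e u) L) :=
    disjoint_siteSet_of_siteDist fun i j => lt_of_le_of_lt (by omega) (hsep i j)
  have h1 := measure_singular_at_shifted_energy_le hV hμ hN hd hΦ hm hm' hn₁ (by omega) hL
    (fun E hE => hq n₁ hn₁ (by omega) E hE (leftPart e u)) hdisj E
  have h2 := measure_singular_at_shifted_energy_le hV hμ hN hd hΦ hm hm' hn₂ (by omega) hL
    (fun E hE => hq n₂ hn₂ (by omega) E hE (rightPart e u)) hdisj.symm E
  have hsub : {ω | IsSingular N Φ (fun s => V s ω) E m h u L} ⊆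
      {ω | ∃ i, IsSingular N Φ (fun s => V s ω)
        (E - cubeEigenvalue Φ h (rightPart e u) L i (fun s => V s ω)) m h (leftPart e u) L} ∪
      {ω | ∃ i, IsSingular N Φ (fun s => V s ω)
        (E - cubeEigenvalue Φ h (leftPart e u) L i (fun s => V s ω)) m h (rightPart e u) L} := by
    intro ω hω
    by_contra hcon
    simp only [Set.mem_union, Set.mem_ofPred_eq, not_or, not_exists, IsSingular, not_not] at hcon
    exact hω (isNonsingular_of_split hm hni hcon.1 hcon.2)
  have hcard : ∀ k, k ≤ n → (((2 * L + 1) ^ (k * d) : ℕ) : ENNReal) * ENNReal.ofReal q ≤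
      ENNReal.ofReal ((2 * L + 1 : ℝ) ^ (n * d) * q) := fun k hk => by
    rw [← ENNReal.ofReal_natCast, ← ENNReal.ofReal_mul (by positivity)]
    apply ENNReal.ofReal_le_ofReal
    push_cast
    gcongr
    linarith [(Nat.cast_nonneg L : (0 : ℝ) ≤ L)]
  rw [card_cube] at h1 h2
  have h3 : P {ω | IsSingular N Φ (fun s => V s ω) E m h u L} ≤
      ENNReal.ofReal (2 * (2 * L + 1 : ℝ) ^ (n * d) * q) := by
    calc _ ≤ _ := measure_mono hsub
      _ ≤ _ := measure_union_le _ _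
      _ ≤ ENNReal.ofReal ((2 * L + 1 : ℝ) ^ (n * d) * q) +
          ENNReal.ofReal ((2 * L + 1 : ℝ) ^ (n * d) * q) :=
        add_le_add (h1.trans (hcard _ (by omega))) (h2.trans (hcard _ (by omega)))
      _ = _ := by
        rw [← ENNReal.ofReal_add (by positivity) (by positivity)]
        congr 1
        ring
  exact ENNReal.toReal_le_of_le_ofReal (by positivity) h3

end PartiallyInteractive

/-! ### Fully interactive cubes -/

section FullyInteractive

variable {n d : ℕ}

theorem siteDist_triangle (x y z : Site d) : siteDist x z ≤ siteDist x y + siteDist y z := by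
  rw [siteDist_le_iff]
  intro a
  have h1 := siteDist_le_iff.1 (le_refl (siteDist x y)) a
  have h2 := siteDist_le_iff.1 (le_refl (siteDist y z)) a
  omega

/-- In a cube that is not partially interactive, all particles are linked by chains with gaps of
length at most `2 L + r₀`. -/
theorem siteDist_le_of_not_isPartiallyInteractive {r₀ : ℕ} {u : Config n d} {L : ℕ}
    (hu : ¬ IsPartiallyInteractive r₀ u L) (i j : Fin n) :
    siteDist (u i) (u j) ≤ n * (2 * L + r₀) := by
  classical
  set D := 2 * L + r₀ with hD
  set J : ℕ → Finset (Fin n) := fun t => Finset.univ.filter fun k => siteDist (u i) (u k) ≤ t * D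
    with hJ
  have hmem : ∀ t k, k ∈ J t ↔ siteDist (u i) (u k) ≤ t * D := fun t k => by simp [hJ]
  have hi : ∀ t, i ∈ J t := fun t => by simp [hmem, siteDist]
  have hcard : ∀ t, min n (t + 1) ≤ (J t).card := by
    intro t
    induction t with
    | zero => exact (min_le_right _ _).trans (Finset.card_pos.2 ⟨i, hi 0⟩)
    | succ t ih =>
      have hsub : J t ⊆ J (t + 1) := fun k hk => by
        rw [hmem] at hk ⊢
        rw [add_mul]
        omega
      by_cases hfull : (J t).card = n
      · exact (min_le_left _ _).trans (hfull.symm.le.trans (Finset.card_le_card hsub))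
      · have hle : (J t).card ≤ n := by simpa using Finset.card_le_univ (J t)
        have hc1 : 1 ≤ (J t).card := Finset.card_pos.2 ⟨i, hi t⟩
        have hc2 : (J t)ᶜ.card = n - (J t).card := by
          rw [Finset.card_compl, Fintype.card_fin]
        by_contra hcon
        have heq : J t = J (t + 1) := Finset.eq_of_subset_of_card_le hsub (by omega)
        refine hu ⟨(J t).card, (J t)ᶜ.card, finSumEquivOfFinset rfl rfl, hc1, by omega,
          fun k l => ?_⟩
        have hk : finSumEquivOfFinset rfl rfl (Sum.inl k) ∈ J t := by
          simp [finSumEquivOfFinset_inl]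
        have hl : finSumEquivOfFinset rfl rfl (Sum.inr l) ∉ J t := by
          rw [← Finset.mem_compl]
          simp only [finSumEquivOfFinset_inr]
          exact Finset.orderEmbOfFin_mem _ _ _
        by_contra hlt
        have hlJ : finSumEquivOfFinset rfl rfl (Sum.inr l) ∉ J (t + 1) := fun h0 =>
          hl (heq.symm.subset h0)
        apply hlJ
        rw [hmem, add_mul]
        rw [hmem] at hk
        have := siteDist_triangle (u i) (u (finSumEquivOfFinset rfl rfl (Sum.inl k)))
          (u (finSumEquivOfFinset rfl rfl (Sum.inr l)))
        omega
  have hn : 1 ≤ n := Nat.one_le_iff_ne_zero.2 (by rintro rfl; exact i.elim0)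
  have hall : J n = Finset.univ := by
    rw [← Finset.card_eq_iff_eq_univ, Fintype.card_fin]
    have h1 := hcard n
    have h2 : (J n).card ≤ n := by simpa using Finset.card_le_univ (J n)
    omega
  exact (hmem n j).1 (hall ▸ Finset.mem_univ j)

theorem disjoint_siteSet_of_not_isPartiallyInteractive {r₀ : ℕ} {x y : Config n d} {L A : ℕ}
    (hx : ¬ IsPartiallyInteractive r₀ x L) (hy : ¬ IsPartiallyInteractive r₀ y L)
    (hA : 2 * L + 2 * (n * (2 * L + r₀)) ≤ A) (hxy : y ∉ cube x A) :
    Disjoint (siteSet x L) (siteSet y L) := by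
  refine disjoint_siteSet_of_siteDist fun i i' => ?_
  by_contra hle
  apply hxy
  rw [mem_cube_iff]
  intro j a
  have h1 := siteDist_le_iff.1 (siteDist_le_of_not_isPartiallyInteractive hx i j) a
  have h2 := siteDist_le_iff.1 (siteDist_le_of_not_isPartiallyInteractive hy i' j) a
  have h3 := siteDist_le_iff.1 (not_lt.1 hle) a
  omega

variable {Ω : Type*} [MeasurableSpace Ω] {P : Measure Ω} {V : Site d → Ω → ℝ} {μ : Measure ℝ}

theorem measureReal_singular_pair_le [IsProbabilityMeasure P] (hV : IsIIDField P V μ) {N : ℕ}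
    {Φ : ℕ → ℝ} {m h E : ℝ} {L : ℕ} {x y : Config n d}
    (hxy : Disjoint (siteSet x L) (siteSet y L)) {q : ℝ}
    (hx : P.real {ω | IsSingular N Φ (fun s => V s ω) E m h x L} ≤ q)
    (hy : P.real {ω | IsSingular N Φ (fun s => V s ω) E m h y L} ≤ q) :
    P.real {ω | IsSingular N Φ (fun s => V s ω) E m h x L ∧
      IsSingular N Φ (fun s => V s ω) E m h y L} ≤ q ^ 2 := by
  have hmeas : ∀ S : Finset (Site d), ∀ z : Config n d, MeasurableSet
      {w : S → ℝ | IsSingular N Φ (extendZero w) E m h z L} := fun S z =>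
    (measurable_id.prodMk measurable_const) (measurableSet_isSingular S)
  have heq : ∀ z : Config n d, {ω | IsSingular N Φ (fun s => V s ω) E m h z L} =
      (fun ω => fun s : siteSet z L => V s ω) ⁻¹'
        {w | IsSingular N Φ (extendZero w) E m h z L} := fun z => by
    ext ω
    exact (isSingular_congr (cubeHamiltonian_restrict Φ (fun s => V s ω) h z L)).symm
  have h1 := (hV.indepFun_restrict hxy).measure_inter_preimage_eq_mul _ _
    (hmeas (siteSet x L) x) (hmeas (siteSet y L) y)
  rw [← heq, ← heq] at h1
  have h2 : P.real {ω | IsSingular N Φ (fun s => V s ω) E m h x L ∧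
      IsSingular N Φ (fun s => V s ω) E m h y L} =
      P.real {ω | IsSingular N Φ (fun s => V s ω) E m h x L} *
      P.real {ω | IsSingular N Φ (fun s => V s ω) E m h y L} := by
    simp only [measureReal_def]
    rw [← ENNReal.toReal_mul, ← h1]
    rfl
  rw [h2, pow_two]
  exact mul_le_mul hx hy measureReal_nonneg (measureReal_nonneg.trans hx)

end FullyInteractive

/-! ### One step of the multiscale analysis at given scales -/

section Step

variable {n d : ℕ}
variable {Ω : Type*} [MeasurableSpace Ω] {P : Measure Ω} {V : Site d → Ω → ℝ} {μ : Measure ℝ}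

/-- Without resonances, singular partially interactive cubes and distant pairs of singular fully
interactive cubes, the singular `L`-cubes in `C_{L'}(u)` form a single cluster. -/
theorem isNonsingular_of_no_bad_pairs (hn : 1 ≤ n) (hd : 1 ≤ d) {N : ℕ} {Φ : ℕ → ℝ} {r₀ : ℕ}
    {W : Site d → ℝ} {E m h : ℝ} {u : Config n d} {L L' A : ℕ} {ε : ℝ} (hε : 0 < ε) (hε1 : ε ≤ 1)
    (hdecay : ∀ t : ℕ, L' ≤ t * (L + 1) + 2 * (A + 1) + 2 * (L + 1) →
      (griConst n d A * ε⁻¹ * (griConst n d L * Real.exp (-(decayRate N m L n * L)))) ^ t * ε⁻¹ ≤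
        Real.exp (-(decayRate N m L' n * L')))
    (hres : ∀ i, ε ≤ |cubeEigenvalue Φ h u L' i W - E|)
    (hresA : ∀ w ∈ cube u L', ∀ i, ε ≤ |cubeEigenvalue Φ h w A i W - E|)
    (hPI : ∀ x ∈ cube u L', IsPartiallyInteractive r₀ x L → IsNonsingular N Φ W E m h x L)
    (hFI : ∀ x ∈ cube u L', ∀ y ∈ cube u L', ¬ IsPartiallyInteractive r₀ x L →
      ¬ IsPartiallyInteractive r₀ y L → y ∉ cube x A →
      ¬ (IsSingular N Φ W E m h x L ∧ IsSingular N Φ W E m h y L)) :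
    IsNonsingular N Φ W E m h u L' := by
  obtain ⟨w, hw, hcl⟩ : ∃ w ∈ cube u L', ∀ x ∈ cube u L', x ∉ cube w A →
      IsNonsingular N Φ W E m h x L := by
    by_cases hex : ∃ w ∈ cube u L', IsSingular N Φ W E m h w L
    · obtain ⟨w, hw, hws⟩ := hex
      refine ⟨w, hw, fun x hx hxw => ?_⟩
      by_contra hxs
      exact hFI w hw x hx (fun h => hws (hPI w hw h)) (fun h => hxs (hPI x hx h)) hxw ⟨hws, hxs⟩
    · push Not at hex
      exact ⟨u, center_mem_cube u L', fun x hx _ => not_not.1 (hex x hx)⟩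
  have hH := isHermitian_cubeHamiltonian Φ W h u L'
  have hHw := isHermitian_cubeHamiltonian Φ W h w A
  have hspec := (abs_resolvent_le hH hε hres ⟨u, center_mem_cube u L'⟩ ⟨u, center_mem_cube u L'⟩).1
  refine ⟨hspec, fun y hy => ?_⟩
  obtain ⟨t, ht, hbound⟩ := abs_green_le_of_cluster hn hd (Real.exp_pos _).le
    ((one_le_inv₀ hε).2 hε1) hw hspec
    (fun x y => (abs_resolvent_le hH hε hres x y).2)
    (abs_resolvent_le hHw hε (hresA w hw) ⟨w, center_mem_cube w A⟩ ⟨w, center_mem_cube w A⟩).1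
    (fun x y => (abs_resolvent_le hHw hε (hresA w hw) x y).2)
    (fun x r hr hx hxw => hcl x (cube_mono (by omega) hx) hxw) y hy
  exact hbound.trans (hdecay t ht)

/-- The union bound over partially interactive cubes, pairs of fully interactive cubes, and
resonances; `D` bounds the number of configurations in `C_{L'}(u)`. -/
theorem measureReal_singular_step_le [IsProbabilityMeasure P] (hV : IsIIDField P V μ)
    {M : ℝ} (hμ : IsAdmissibleLaw μ M) {C : ℝ} (hC : 0 ≤ C)
    (hCμ : ∀ B, μ B ≤ ENNReal.ofReal C * volume B)
    {N : ℕ} (hd : 1 ≤ d) {Φ : ℕ → ℝ} {r₀ : ℕ}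
    (hΦ : Function.support Φ ⊆ Set.Icc 0 r₀) {m h : ℝ} (hm : 0 ≤ m)
    (hm' : m ≤ 1 / (2 ^ (N + 1) * (12 * N * d))) (hn1 : 1 ≤ n) (hn : n ≤ N) {L L' A : ℕ}
    (hL : 1 ≤ L) (hA : 2 * L + 2 * (n * (2 * L + r₀)) ≤ A) (hA' : A ≤ L')
    {ε : ℝ} (hε : 0 < ε) (hε1 : ε ≤ 1)
    (hdecay : ∀ t : ℕ, L' ≤ t * (L + 1) + 2 * (A + 1) + 2 * (L + 1) →
      (griConst n d A * ε⁻¹ * (griConst n d L * Real.exp (-(decayRate N m L n * L)))) ^ t * ε⁻¹ ≤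
        Real.exp (-(decayRate N m L' n * L')))
    {q q' : ℝ} (hq'0 : 0 ≤ q')
    (hq' : ∀ n', 1 ≤ n' → n' < n → ∀ E ∈ energyInterval N d Φ M h, ∀ u' : Config n' d,
      P.real {ω | IsSingular N Φ (fun s => V s ω) E m h u' L} ≤ q')
    {E : ℝ} (hq : ∀ u : Config n d, P.real {ω | IsSingular N Φ (fun s => V s ω) E m h u L} ≤ q)
    (u : Config n d) {D : ℝ} (hD : ((2 * L' + 1 : ℕ) : ℝ) ^ (n * d) ≤ D) :
    P.real {ω | IsSingular N Φ (fun s => V s ω) E m h u L'} ≤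
      2 * D ^ 2 * q' + D ^ 2 * q ^ 2 + 4 * C * ε * D ^ 3 := by
  classical
  have hcardL' : ((cube u L').card : ℝ) ≤ D := by
    rw [card_cube]; exact_mod_cast hD
  have hD1 : 1 ≤ D := by
    refine le_trans ?_ hcardL'
    exact_mod_cast Finset.card_pos.2 ⟨u, center_mem_cube u L'⟩
  have hcard : ∀ (w : Config n d) (l : ℕ), l ≤ L' → ((cube w l).card : ℝ) ≤ D := fun w l hl => by
    refine le_trans ?_ hcardL'
    rw [card_cube, card_cube]
    exact_mod_cast Nat.pow_le_pow_left (by omega) _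
  set PIs := (cube u L').filter fun x => IsPartiallyInteractive r₀ x L with hPIs
  set FIs := ((cube u L') ×ˢ (cube u L')).filter fun p =>
    ¬ IsPartiallyInteractive r₀ p.1 L ∧ ¬ IsPartiallyInteractive r₀ p.2 L ∧ p.2 ∉ cube p.1 A
    with hFIs
  set S : Config n d → Set Ω := fun x => {ω | IsSingular N Φ (fun s => V s ω) E m h x L} with hS
  set R : Config n d → ℕ → Set Ω := fun w l =>
    {ω | ∃ i, |cubeEigenvalue Φ h w l i (fun s => V s ω) - E| < ε} with hR
  have hsub : {ω | IsSingular N Φ (fun s => V s ω) E m h u L'} ⊆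
      ((⋃ x ∈ PIs, S x) ∪ (⋃ p ∈ FIs, (S p.1 ∩ S p.2))) ∪ (R u L' ∪ ⋃ w ∈ cube u L', R w A) := by
    intro ω hω
    by_contra hcon
    simp only [Set.mem_union, Set.mem_iUnion, not_or, not_exists, hPIs, hFIs, Finset.mem_filter,
      Finset.mem_product, hS, hR, Set.mem_ofPred_eq, Set.mem_inter_iff, not_lt] at hcon
    obtain ⟨⟨h1, h2⟩, h3, h4⟩ := hcon
    refine hω (isNonsingular_of_no_bad_pairs (r₀ := r₀) hn1 hd hε hε1 hdecay h3 h4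
      (fun x hx hp => not_not.1 (h1 x ⟨hx, hp⟩)) fun x hx y hy hpx hpy hxy => ?_)
    exact h2 (x, y) ⟨⟨hx, hy⟩, hpx, hpy, hxy⟩
  have hb1 : P.real (⋃ x ∈ PIs, S x) ≤ 2 * D ^ 2 * q' := by
    refine (measureReal_biUnion_finset_le _ _).trans ?_
    have h1 : ∀ x ∈ PIs, P.real (S x) ≤ 2 * D * q' := fun x hx => by
      refine (measureReal_singular_le_of_isPartiallyInteractive hV hμ (hn1.trans hn) hd hΦ hm hm' hn
        hL hq'0 hq' (Finset.mem_filter.1 hx).2 E).trans ?_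
      have h2 := hcard x L (by omega)
      rw [card_cube] at h2
      push_cast at h2
      gcongr
    refine (Finset.sum_le_sum h1).trans ?_
    rw [Finset.sum_const, nsmul_eq_mul]
    have h2 : (PIs.card : ℝ) ≤ D :=
      le_trans (by exact_mod_cast Finset.card_filter_le _ _) hcardL'
    calc (PIs.card : ℝ) * (2 * D * q') ≤ D * (2 * D * q') := by gcongr
      _ = _ := by ring
  have hb2 : P.real (⋃ p ∈ FIs, (S p.1 ∩ S p.2)) ≤ D ^ 2 * q ^ 2 := by
    refine (measureReal_biUnion_finset_le _ _).trans ?_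
    have h1 : ∀ p ∈ FIs, P.real (S p.1 ∩ S p.2) ≤ q ^ 2 := fun p hp => by
      obtain ⟨-, hp1, hp2, hp3⟩ := Finset.mem_filter.1 hp
      exact measureReal_singular_pair_le hV
        (disjoint_siteSet_of_not_isPartiallyInteractive hp1 hp2 hA hp3) (hq _) (hq _)
    refine (Finset.sum_le_sum h1).trans ?_
    rw [Finset.sum_const, nsmul_eq_mul]
    have h2 : (FIs.card : ℝ) ≤ D ^ 2 := by
      have h3 : (FIs.card : ℝ) ≤ (cube u L').card * (cube u L').card := by
        exact_mod_cast (Finset.card_filter_le _ _).trans (Finset.card_product _ _).le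
      nlinarith [(Nat.cast_nonneg (cube u L').card : (0 : ℝ) ≤ _)]
    gcongr
  have hbR : ∀ w l, l ≤ L' → P.real (R w l) ≤ 2 * C * ε * D ^ 2 := fun w l hl => by
    refine (hV.wegner hC hCμ Φ h hn1 w l E hε.le).trans ?_
    have := hcard w l hl
    gcongr
  have hb3 : P.real (R u L' ∪ ⋃ w ∈ cube u L', R w A) ≤ 4 * C * ε * D ^ 3 := by
    refine (measureReal_union_le _ _).trans ?_
    have h1 : P.real (⋃ w ∈ cube u L', R w A) ≤ D * (2 * C * ε * D ^ 2) := by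
      refine (measureReal_biUnion_finset_le _ _).trans
        ((Finset.sum_le_sum fun w _ => hbR w A hA').trans ?_)
      rw [Finset.sum_const, nsmul_eq_mul]
      gcongr
    have h2 := hbR u L' le_rfl
    have h3 : 2 * C * ε * D ^ 2 ≤ D * (2 * C * ε * D ^ 2) :=
      le_mul_of_one_le_left (by positivity) hD1
    calc _ ≤ _ := add_le_add h2 h1
      _ ≤ _ := add_le_add_left h3 _
      _ = _ := by ring
  calc _ ≤ _ := measureReal_mono hsub
    _ ≤ _ := measureReal_union_le _ _
    _ ≤ _ := add_le_add ((measureReal_union_le _ _).trans (add_le_add hb1 hb2)) hb3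

end Step

end MultiParticleAnderson

namespace MultiParticleAnderson

/-! ### Asymptotics of the length scales -/

section Asymptotics

open Filter

theorem tendsto_sqrt_natCast : Tendsto (fun L : ℕ => √(L : ℝ)) atTop atTop :=
  Real.tendsto_sqrt_atTop.comp tendsto_natCast_atTop_atTop

theorem eventually_le_rpow {s : ℝ} (hs : 0 < s) (C : ℝ) : ∀ᶠ L : ℕ in atTop, C ≤ (L : ℝ) ^ s :=
  ((tendsto_rpow_atTop hs).comp tendsto_natCast_atTop_atTop).eventually_ge_atTop C

theorem eventually_mul_pow_le_exp_sqrt (C : ℝ) (k : ℕ) {c : ℝ} (hc : 0 < c) :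
    ∀ᶠ L : ℕ in atTop, C * (L : ℝ) ^ k ≤ Real.exp (c * √L) := by
  have h1 : Tendsto (fun x : ℝ => C * (x ^ (2 * k) / Real.exp (c * x))) atTop (nhds (C * 0)) := by
    refine Tendsto.const_mul C ?_
    have h0 := Real.tendsto_pow_mul_exp_neg_atTop_nhds_zero (2 * k)
    have h2 := h0.comp (tendsto_id.const_mul_atTop hc)
    have h3 := h2.const_mul ((c ^ (2 * k))⁻¹)
    rw [mul_zero] at h3
    refine h3.congr fun x => ?_
    simp only [Function.comp_apply, id, mul_pow, Real.exp_neg]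
    field_simp
  rw [mul_zero] at h1
  have h2 := (h1.comp tendsto_sqrt_natCast).eventually_le_const zero_lt_one
  filter_upwards [h2] with L hL
  have h3 : √(L : ℝ) ^ (2 * k) = (L : ℝ) ^ k := by
    rw [pow_mul, Real.sq_sqrt (Nat.cast_nonneg L)]
  simp only [Function.comp_apply, h3, ← mul_div_assoc] at hL
  rwa [div_le_one (Real.exp_pos _)] at hL

theorem eventually_mul_log_sq_le_sqrt {K : ℝ} (hK : 0 < K) {c : ℝ} (hc : 0 < c) :
    ∀ᶠ L : ℕ in atTop, K * Real.log L ^ 2 ≤ c * √L := by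
  have h1 := (Real.isLittleO_pow_log_id_atTop (n := 2)).bound
    (show 0 < c / (4 * K) by positivity)
  filter_upwards [tendsto_sqrt_natCast.eventually h1, eventually_ge_atTop 1] with L hL hL1
  have h2 : Real.log (√(L : ℝ)) = Real.log L / 2 := Real.log_sqrt (Nat.cast_nonneg L)
  rw [h2, Real.norm_of_nonneg (by positivity), id, Real.norm_of_nonneg (by positivity)] at hL
  have h3 : K * Real.log L ^ 2 = 4 * K * (Real.log L / 2) ^ 2 := by ring
  rw [h3]
  calc 4 * K * (Real.log L / 2) ^ 2 ≤ 4 * K * (c / (4 * K) * √L) := by gcongr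
    _ = c * √L := by field_simp

theorem griConst_le {N n d L A : ℕ} (hn : n ≤ N) (hL : 1 ≤ L) (hN : 1 ≤ N) (hA : A ≤ 8 * N * L) :
    griConst n d A ≤ ((17 * N : ℝ) ^ (N * d) * (2 * N * d)) * (L : ℝ) ^ (N * d) := by
  have hL' : (1 : ℝ) ≤ L := by exact_mod_cast hL
  have hN' : (1 : ℝ) ≤ N := by exact_mod_cast hN
  have hA' : (A : ℝ) ≤ 8 * N * L := by exact_mod_cast hA
  have hNL : (1 : ℝ) ≤ N * L := by nlinarith
  have h1 : (2 * A + 1 : ℝ) ≤ 17 * N * L := by nlinarith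
  have h2 : (1 : ℝ) ≤ 17 * N * L := by nlinarith
  unfold griConst
  calc (2 * A + 1 : ℝ) ^ (n * d) * (2 * n * d) ≤ (17 * N * L : ℝ) ^ (n * d) * (2 * N * d) := by
        gcongr
    _ ≤ (17 * N * L : ℝ) ^ (N * d) * (2 * N * d) := by
        gcongr
    _ = _ := by rw [mul_pow]; ring

/-- The loss of decay rate from `L` to `L'` allowed by the definition of `γ`. -/
theorem mul_sub_le_decayRate_sub {N : ℕ} {m : ℝ} (hm : 0 ≤ m) {L L' n : ℕ} (hL : 1 ≤ L)
    (hLL' : (L : ℝ) ^ (3 / 2 : ℝ) ≤ L') :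
    m * ((L : ℝ) ^ (-(1 / 8 : ℝ)) - (L : ℝ) ^ (-(3 / 16 : ℝ))) ≤
      decayRate N m L n - decayRate N m L' n := by
  have hL0 : (1 : ℝ) ≤ L := by exact_mod_cast hL
  have h1 : (L' : ℝ) ^ (-(1 / 8 : ℝ)) ≤ (L : ℝ) ^ (-(3 / 16 : ℝ)) := by
    calc (L' : ℝ) ^ (-(1 / 8 : ℝ)) ≤ ((L : ℝ) ^ (3 / 2 : ℝ)) ^ (-(1 / 8 : ℝ)) :=
          Real.rpow_le_rpow_of_nonpos (by positivity) hLL' (by norm_num)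
      _ = (L : ℝ) ^ (-(3 / 16 : ℝ)) := by
          rw [← Real.rpow_mul (by positivity)]; norm_num
  have h2 : (L : ℝ) ^ (-(3 / 16 : ℝ)) ≤ (L : ℝ) ^ (-(1 / 8 : ℝ)) :=
    Real.rpow_le_rpow_of_exponent_le hL0 (by norm_num)
  set a : ℝ := (L : ℝ) ^ (-(1 / 8 : ℝ))
  set b : ℝ := (L' : ℝ) ^ (-(1 / 8 : ℝ)) with hb
  have hb0 : 0 ≤ b := by positivity
  unfold decayRate
  rw [← mul_sub]
  apply mul_le_mul_of_nonneg_left _ hm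
  rw [← hb]
  have h3 : (1 + b) ^ (N - n) ≤ (1 + a) ^ (N - n) := by gcongr; linarith
  have h4 : 1 ≤ (1 + b) ^ (N - n) := one_le_pow₀ (by linarith)
  rw [pow_succ, pow_succ]
  nlinarith

/-- The exponent reached after `t` steps of the radial descent, each with gain `γ L - 2 √L`. -/
theorem descent_exponent_le {N L L' t γ γ' s : ℝ} (hN : 0 ≤ N) (hγ : 0 ≤ γ) (hs1 : 1 ≤ s)
    (hss : s * s = L) (hsL : s ^ 3 ≤ L') (hK : 20 * N * γ + γ + 3 ≤ (γ - γ') * s)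
    (hrate : 2 * s ≤ γ * L) (ht : L' ≤ (t + 20 * N) * (L + 1)) :
    t * -(γ * L - 2 * s) + s ≤ -(γ' * L') := by
  have hs0 : 0 < s := by linarith
  have hL0 : 0 < L := by rw [← hss]; positivity
  have hL'0 : 0 ≤ L' := le_trans (by positivity) hsL
  have hτ : L' / (L + 1) - 20 * N ≤ t := by
    have := (div_le_iff₀ (by positivity : (0 : ℝ) < L + 1)).2 ht
    linarith
  have h1 : (L' / (L + 1) - 20 * N) * (γ * L - 2 * s) ≤ t * (γ * L - 2 * s) :=
    mul_le_mul_of_nonneg_right hτ (by linarith)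
  have h2 : L' * γ - L' * ((γ + 2 * s) / L) ≤ L' / (L + 1) * (γ * L - 2 * s) := by
    have e : L' / (L + 1) * (γ * L - 2 * s) = L' * γ - L' * ((γ + 2 * s) / (L + 1)) := by
      field_simp
      ring
    rw [e]
    have : (γ + 2 * s) / (L + 1) ≤ (γ + 2 * s) / L :=
      div_le_div_of_nonneg_left (by positivity) hL0 (by linarith)
    have := mul_le_mul_of_nonneg_left this hL'0
    linarith
  have h3 : 20 * N * (γ * L - 2 * s) + s ≤ L' * ((20 * N * γ + 1) / s) := by
    have e : s ^ 3 * ((20 * N * γ + 1) / s) = 20 * N * (γ * L) + L := by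
      rw [← hss]; field_simp
    have h4 : s ^ 3 * ((20 * N * γ + 1) / s) ≤ L' * ((20 * N * γ + 1) / s) :=
      mul_le_mul_of_nonneg_right hsL (by positivity)
    have h5 : s ≤ L := by rw [← hss]; exact le_mul_of_one_le_left hs0.le hs1
    have h6 : 0 ≤ N * s := by positivity
    linarith
  have h4 : (γ + 2 * s) / L + (20 * N * γ + 1) / s ≤ γ - γ' := by
    have e : (γ + 2 * s) / L + (20 * N * γ + 1) / s = (γ / s + 2 + 20 * N * γ + 1) / s := by
      rw [← hss]; field_simp; ring
    rw [e, div_le_iff₀ hs0]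
    have h5 : γ / s ≤ γ := div_le_self hγ hs1
    linarith
  have h5 := mul_le_mul_of_nonneg_left h4 hL'0
  rw [mul_add] at h5
  linarith

/-- The radial descent through the scales `L` and `L' ≥ L ^ (3/2)` yields the decay rate required
at the scale `L'`: the losses are of relative order `L ^ (-1/2)`, while `γ(m, L, n)` exceeds
`γ(m, L', n)` by an amount of order `L ^ (-1/8)`. -/
theorem eventually_decay {N d n : ℕ} (hN : 1 ≤ N) (hn1 : 1 ≤ n) (hn : n ≤ N) (hd : 1 ≤ d) {m : ℝ}
    (hm : 0 < m) :
    ∀ᶠ L : ℕ in atTop, ∀ L' : ℕ, (L : ℝ) ^ (3 / 2 : ℝ) ≤ L' → ∀ t : ℕ,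
      L' ≤ t * (L + 1) + 2 * (8 * N * L + 1) + 2 * (L + 1) →
      (griConst n d (8 * N * L) * (Real.exp (-√L))⁻¹ *
        (griConst n d L * Real.exp (-(decayRate N m L n * L)))) ^ t * (Real.exp (-√L))⁻¹ ≤
        Real.exp (-(decayRate N m L' n * L')) := by
  set K : ℝ := m * 2 ^ N * (1 + 20 * N) + 3 with hK
  have hK0 : 0 < K := by positivity
  filter_upwards [eventually_ge_atTop 1,
    eventually_mul_pow_le_exp_sqrt (((17 * N : ℝ) ^ (N * d) * (2 * N * d)) ^ 2) (2 * (N * d))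
      zero_lt_one,
    tendsto_sqrt_natCast.eventually_ge_atTop (2 / m),
    eventually_le_rpow (s := 1 / 16) (by norm_num) 2,
    eventually_le_rpow (s := 1 / 16) (by norm_num) (2 * K / m)] with L hL hgri hsqrt hy2 hyK
  intro L' hLL' t ht
  set γ := decayRate N m L n with hγ
  set γ' := decayRate N m L' n with hγ'
  have hN' : (1 : ℝ) ≤ N := by exact_mod_cast hN
  have hL0 : (1 : ℝ) ≤ L := by exact_mod_cast hL
  set s := √(L : ℝ) with hs
  have hs1 : 1 ≤ s := Real.one_le_sqrt.2 hL0
  have hss : s * s = L := Real.mul_self_sqrt (by positivity)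
  have hsL : s ^ 3 ≤ L' := by
    have : (L : ℝ) ^ (3 / 2 : ℝ) = s ^ 3 := by
      rw [hs, Real.sqrt_eq_rpow, ← Real.rpow_natCast, ← Real.rpow_mul (by positivity)]
      norm_num
    rwa [← this]
  have hγm : m ≤ γ := le_mul_of_one_le_right hm.le
    (one_le_pow₀ (le_add_of_nonneg_right (by positivity)))
  have hγle : γ ≤ m * 2 ^ N := decayRate_le hm.le hL hn1 hN
  have hγ0 : 0 < γ := hm.trans_le hγm
  -- the gain in the rate
  have hgain : K ≤ (γ - γ') * s := by
    have h1 := mul_sub_le_decayRate_sub (N := N) (n := n) hm.le hL hLL'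
    set y : ℝ := (L : ℝ) ^ (1 / 16 : ℝ) with hydef
    have hypos : 0 < y := by linarith
    have hpow : ∀ k : ℕ, y ^ k = (L : ℝ) ^ ((k : ℝ) / 16) := fun k => by
      rw [hydef, ← Real.rpow_natCast, ← Real.rpow_mul (by positivity)]
      congr 1; ring
    have e1 : (L : ℝ) ^ (-(1 / 8 : ℝ)) = (y ^ 2)⁻¹ := by
      rw [hpow, ← Real.rpow_neg (by positivity)]; norm_num
    have e2 : (L : ℝ) ^ (-(3 / 16 : ℝ)) = (y ^ 3)⁻¹ := by
      rw [hpow, ← Real.rpow_neg (by positivity)]; norm_num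
    have e3 : s = y ^ 8 := by
      rw [hpow, hs, Real.sqrt_eq_rpow]; norm_num
    rw [e1, e2] at h1
    have h2 : m * ((y ^ 2)⁻¹ - (y ^ 3)⁻¹) * y ^ 8 = m * y ^ 5 * (y - 1) := by
      field_simp
    have h3 : m * y ^ 5 * (y - 1) ≤ (γ - γ') * s := by
      rw [← h2, e3]
      exact mul_le_mul_of_nonneg_right h1 (by positivity)
    have h4 : K ≤ m * y := by
      have : 2 * K ≤ m * y := by rwa [div_le_iff₀' hm] at hyK
      linarith
    have h5 : y ≤ y ^ 5 := le_self_pow₀ (by linarith) (by norm_num)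
    have h6 : y ^ 5 ≤ y ^ 5 * (y - 1) := le_mul_of_one_le_right (by positivity) (by linarith)
    have h7 : m * y ≤ m * (y ^ 5 * (y - 1)) := mul_le_mul_of_nonneg_left (h5.trans h6) hm.le
    linarith
  -- one step gains at least `exp (2 √L - γ L)`
  have hstep : griConst n d (8 * N * L) * (Real.exp (-s))⁻¹ *
      (griConst n d L * Real.exp (-(γ * L))) ≤ Real.exp (-(γ * L - 2 * s)) := by
    have h1 := griConst_le (d := d) (A := 8 * N * L) hn hL hN le_rfl
    have h2 := griConst_le (d := d) (A := L) hn hL hN (by nlinarith)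
    have h3 : 0 ≤ griConst n d L := zero_le_one.trans (one_le_griConst hn1 hd L)
    have h4 : griConst n d (8 * N * L) * griConst n d L ≤ Real.exp s := by
      refine (mul_le_mul h1 h2 h3 (by positivity)).trans (le_trans (le_of_eq ?_)
        (hgri.trans_eq (by rw [one_mul])))
      ring
    have h5 : Real.exp (-(γ * L - 2 * s)) = Real.exp s * (Real.exp s * Real.exp (-(γ * L))) := by
      rw [← Real.exp_add, ← Real.exp_add]; congr 1; ring
    rw [h5, Real.exp_neg s, inv_inv]
    calc griConst n d (8 * N * L) * Real.exp s * (griConst n d L * Real.exp (-(γ * L)))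
        = griConst n d (8 * N * L) * griConst n d L * (Real.exp s * Real.exp (-(γ * L))) := by ring
      _ ≤ _ := by gcongr
  have hstep0 : 0 ≤ griConst n d (8 * N * L) * (Real.exp (-s))⁻¹ *
      (griConst n d L * Real.exp (-(γ * L))) := by
    have h3 : 0 ≤ griConst n d L := zero_le_one.trans (one_le_griConst hn1 hd L)
    have h4 : 0 ≤ griConst n d (8 * N * L) := zero_le_one.trans (one_le_griConst hn1 hd _)
    positivity
  refine (mul_le_mul_of_nonneg_right (pow_le_pow_left₀ hstep0 hstep t) (by positivity)).trans ?_
  rw [Real.exp_neg s, inv_inv, ← Real.exp_nat_mul, ← Real.exp_add, Real.exp_le_exp]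
  -- the number of steps
  have ht' : (L' : ℝ) ≤ (t + 20 * N) * (L + 1) := by
    have h1 : (L' : ℝ) ≤ t * (L + 1) + 2 * (8 * N * L + 1) + 2 * (L + 1) := by exact_mod_cast ht
    nlinarith
  have hrate : 2 * s ≤ γ * L := by
    have : 2 ≤ m * s := by rwa [div_le_iff₀' hm] at hsqrt
    rw [← hss]
    nlinarith
  have hKγ : 20 * N * γ + γ + 3 ≤ (γ - γ') * s := by
    refine le_trans ?_ hgain
    rw [hK]
    have h6 : (N : ℝ) * γ ≤ N * (m * 2 ^ N) := mul_le_mul_of_nonneg_left hγle (by positivity)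
    linarith
  exact descent_exponent_le (Nat.cast_nonneg N) hγ0.le hs1 hss hsL hKγ hrate ht'

end Asymptotics

section Scales

open Filter

theorem two_mul_add_one_pow_le {x : ℝ} (hx1 : 1 ≤ x) {L' : ℕ}
    (hL' : (L' : ℝ) ≤ x ^ (3 / 2 : ℝ) + 1) (k : ℕ) :
    ((2 * L' + 1 : ℕ) : ℝ) ^ k ≤ 5 ^ k * x ^ (2 * k) := by
  have h1 : x ^ (3 / 2 : ℝ) ≤ x ^ 2 := by
    rw [← Real.rpow_natCast]
    exact Real.rpow_le_rpow_of_exponent_le hx1 (by norm_num)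
  have h2 : ((2 * L' + 1 : ℕ) : ℝ) ≤ 5 * x ^ 2 := by
    push_cast
    nlinarith
  calc ((2 * L' + 1 : ℕ) : ℝ) ^ k ≤ (5 * x ^ 2) ^ k := by gcongr
    _ = 5 ^ k * x ^ (2 * k) := by rw [mul_pow, ← pow_mul]

theorem rpow_neg_le_of_le {x y η s : ℝ} (hx1 : 1 ≤ x) (hη : 2 ≤ x ^ η) (hy1 : 1 ≤ y)
    (hy : y ≤ x ^ (3 / 2 : ℝ) + 1) (hs : 0 ≤ s) : x ^ (-((3 / 2 + η) * s)) ≤ y ^ (-s) := by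
  have hx0 : 0 < x := by linarith
  have hx32 : 1 ≤ x ^ (3 / 2 : ℝ) := Real.one_le_rpow hx1 (by norm_num)
  have h1 : y ≤ x ^ (3 / 2 + η) := by
    rw [Real.rpow_add hx0]
    nlinarith
  have e : x ^ (-((3 / 2 + η) * s)) = (x ^ (3 / 2 + η)) ^ (-s) := by
    rw [← Real.rpow_mul hx0.le, mul_neg]
  rw [e]
  exact Real.rpow_le_rpow_of_nonpos (by linarith) h1 (by linarith)

/-- The contribution of partially interactive cubes and of pairs. -/
theorem three_mul_pairs_le {x c D b β K : ℝ} (hx1 : 1 ≤ x) (hD : D ^ 2 ≤ c ^ 2 * x ^ (4 * K))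
    (hc : 6 * c ^ 2 ≤ x ^ (K / 2)) (hβ : 9 / 2 * K ≤ 2 * b - β) :
    3 * (D ^ 2 * x ^ (-(2 * b))) ≤ x ^ (-β) / 2 := by
  have hx0 : 0 < x := by linarith
  have h1 : 6 * (c ^ 2 * x ^ (4 * K) * x ^ (-(2 * b))) ≤ x ^ (-β) := by
    calc 6 * (c ^ 2 * x ^ (4 * K) * x ^ (-(2 * b)))
        = 6 * c ^ 2 * (x ^ (4 * K) * x ^ (-(2 * b))) := by ring
      _ ≤ x ^ (K / 2) * (x ^ (4 * K) * x ^ (-(2 * b))) := by gcongr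
      _ = x ^ (K / 2 + (4 * K + -(2 * b))) := by
        rw [Real.rpow_add hx0, Real.rpow_add hx0]
      _ ≤ x ^ (-β) := Real.rpow_le_rpow_of_exponent_le hx1 (by linarith)
  have h2 : D ^ 2 * x ^ (-(2 * b)) ≤ c ^ 2 * x ^ (4 * K) * x ^ (-(2 * b)) := by gcongr
  linarith

/-- The contribution of resonances. -/
theorem four_mul_resonances_le {x c D b β C : ℝ} {k : ℕ} (hx1 : 1 ≤ x) (hC : 0 ≤ C)
    (hD : D ^ 3 ≤ c ^ 3 * x ^ k) (hexp : 8 * C * c ^ 3 * x ^ k ≤ Real.exp (1 / 2 * √x))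
    (hlog : Real.log x * (2 * b) ≤ 1 / 2 * √x) (hβ : β ≤ 2 * b) :
    4 * C * Real.exp (-√x) * D ^ 3 ≤ x ^ (-β) / 2 := by
  have hx0 : 0 < x := by linarith
  have h1 : x ^ (2 * b) ≤ Real.exp (1 / 2 * √x) := by
    rw [Real.rpow_def_of_pos hx0, Real.exp_le_exp]
    exact hlog
  have h3 : 8 * C * c ^ 3 * x ^ k * x ^ (2 * b) ≤ Real.exp √x := by
    calc 8 * C * c ^ 3 * x ^ k * x ^ (2 * b)
        ≤ Real.exp (1 / 2 * √x) * Real.exp (1 / 2 * √x) := by gcongr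
      _ = Real.exp √x := by rw [← Real.exp_add]; congr 1; ring
  have h4 : 8 * C * c ^ 3 * x ^ k * Real.exp (-√x) ≤ x ^ (-(2 * b)) := by
    rw [Real.exp_neg, Real.rpow_neg hx0.le, ← div_eq_mul_inv, ← one_div,
      div_le_div_iff₀ (Real.exp_pos _) (by positivity), one_mul]
    exact h3
  have h5 : x ^ (-(2 * b)) ≤ x ^ (-β) := Real.rpow_le_rpow_of_exponent_le hx1 (by linarith)
  have h6 : 4 * C * Real.exp (-√x) * D ^ 3 ≤ 4 * C * Real.exp (-√x) * (c ^ 3 * x ^ k) := by gcongr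
  linarith

/-- The probability bounds at scale `L` add up to the one required at scale `L' ≈ L ^ (3/2)`:
since `(3/2) (1 + θ) < 2`, a pair of independent bad events is sufficiently improbable, and
`p > 6Nd / (1 - 3θ)` leaves room for the number of pairs. -/
theorem eventually_probability_le {N d : ℕ} (hN : 1 ≤ N) (hd : 1 ≤ d) {θ p C : ℝ} (hθ : 0 < θ)
    (hθ' : θ < 1 / 3) (hp : 6 * N * d / (1 - 3 * θ) < p) (hC : 0 ≤ C) :
    ∀ᶠ L : ℕ in atTop, ∀ L' : ℕ, 1 ≤ L' → (L' : ℝ) ≤ (L : ℝ) ^ (3 / 2 : ℝ) + 1 →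
      ∀ b : ℝ, 2 * p ≤ b → b ≤ 2 * p * 4 ^ N * Real.log L →
      2 * (((2 * L' + 1 : ℕ) : ℝ) ^ (N * d)) ^ 2 * (L : ℝ) ^ (-(4 * b)) +
        (((2 * L' + 1 : ℕ) : ℝ) ^ (N * d)) ^ 2 * ((L : ℝ) ^ (-b)) ^ 2 +
        4 * C * Real.exp (-√L) * (((2 * L' + 1 : ℕ) : ℝ) ^ (N * d)) ^ 3 ≤
      (L' : ℝ) ^ (-((1 + θ) * b)) := by
  have hNd : (1 : ℝ) ≤ N * d := by exact_mod_cast Nat.mul_le_mul hN hd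
  have hθ3 : 0 < 1 - 3 * θ := by linarith
  have hp1 : 6 * (N * d) < p * (1 - 3 * θ) := by
    rw [div_lt_iff₀ hθ3] at hp; linarith
  have hp0 : 0 < p := lt_trans (by positivity) hp
  -- `η` absorbs the rounding `L' ≤ L ^ (3/2 + η)`; `β` is then the exponent required at `L'`
  set η : ℝ := (1 - 3 * θ) / 16 with hη
  have hη0 : 0 < η := by positivity
  set c : ℝ := 5 ^ (N * d) with hc
  have hc0 : 0 < c := by positivity
  filter_upwards [eventually_ge_atTop 1, eventually_le_rpow hη0 2,
    eventually_le_rpow (s := (N * d : ℝ) / 2) (by positivity) (6 * c ^ 2),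
    eventually_mul_pow_le_exp_sqrt (8 * C * c ^ 3) (6 * (N * d)) (c := 1 / 2) (by norm_num),
    eventually_mul_log_sq_le_sqrt (K := 4 * p * 4 ^ N) (by positivity) (c := 1 / 2)
      (by norm_num)] with L hL hLη hLc hLexp hLlog
  intro L' hL'1 hL' b hb hb'
  set x : ℝ := (L : ℝ) with hx
  have hx1 : (1 : ℝ) ≤ x := by rw [hx]; exact_mod_cast hL
  have hx0 : 0 < x := by linarith
  have hL'0 : (1 : ℝ) ≤ L' := by exact_mod_cast hL'1
  have hb0 : 0 < b := by linarith
  set β : ℝ := (3 / 2 + η) * ((1 + θ) * b) with hβ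
  have hβ1 : 9 / 2 * (N * d) ≤ 2 * b - β := by
    have e : 2 * b - β = b * ((1 - 3 * θ) / 2 - η * (1 + θ)) := by rw [hβ]; ring
    have h1 : η * (1 + θ) ≤ (1 - 3 * θ) / 8 := by rw [hη]; nlinarith
    have h2 : 3 / 8 * (1 - 3 * θ) ≤ (1 - 3 * θ) / 2 - η * (1 + θ) := by linarith
    rw [e]
    calc 9 / 2 * (N * d : ℝ) ≤ 2 * p * (3 / 8 * (1 - 3 * θ)) := by linarith
      _ ≤ b * ((1 - 3 * θ) / 2 - η * (1 + θ)) := by gcongr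
  have hD := two_mul_add_one_pow_le hx1 hL' (N * d)
  rw [← hc] at hD
  set D : ℝ := ((2 * L' + 1 : ℕ) : ℝ) ^ (N * d)
  have hD0 : 0 ≤ D := by positivity
  have htarget : x ^ (-β) ≤ (L' : ℝ) ^ (-((1 + θ) * b)) :=
    rpow_neg_le_of_le hx1 hLη hL'0 hL' (by positivity)
  have hD2 : D ^ 2 ≤ c ^ 2 * x ^ (4 * (N * d : ℝ)) := by
    have e : x ^ (4 * (N * d : ℝ)) = (x ^ (2 * (N * d))) ^ 2 := by
      rw [← pow_mul, ← Real.rpow_natCast]; congr 1; push_cast; ring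
    rw [e, ← mul_pow]
    gcongr
  have hD3 : D ^ 3 ≤ c ^ 3 * x ^ (6 * (N * d)) := by
    have e : x ^ (6 * (N * d)) = (x ^ (2 * (N * d))) ^ 3 := by
      rw [← pow_mul]; congr 1; ring
    rw [e, ← mul_pow]
    gcongr
  have hq2 : (x ^ (-b)) ^ 2 = x ^ (-(2 * b)) := by
    rw [← Real.rpow_natCast, ← Real.rpow_mul hx0.le]; congr 1; push_cast; ring
  have hq4 : x ^ (-(4 * b)) ≤ x ^ (-(2 * b)) :=
    Real.rpow_le_rpow_of_exponent_le hx1 (by linarith)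
  have hpairs := three_mul_pairs_le hx1 hD2 hLc hβ1
  have hres := four_mul_resonances_le hx1 hC hD3 hLexp (b := b) (β := β) (by
    refine le_trans ?_ hLlog
    have h2 : 0 ≤ Real.log x := Real.log_nonneg hx1
    nlinarith) (by linarith)
  have h7 : D ^ 2 * x ^ (-(4 * b)) ≤ D ^ 2 * x ^ (-(2 * b)) := by gcongr
  rw [hq2]
  linarith

theorem scale_succ (L₀ k : ℕ) :
    scale L₀ (k + 1) = ⌊(scale L₀ k : ℝ) ^ (3 / 2 : ℝ)⌋₊ + 1 := rfl

theorem rpow_le_scale_succ (L₀ k : ℕ) :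
    (scale L₀ k : ℝ) ^ (3 / 2 : ℝ) ≤ scale L₀ (k + 1) := by
  rw [scale_succ]
  push_cast
  exact (Nat.lt_floor_add_one _).le

theorem scale_succ_le (L₀ k : ℕ) :
    (scale L₀ (k + 1) : ℝ) ≤ (scale L₀ k : ℝ) ^ (3 / 2 : ℝ) + 1 := by
  rw [scale_succ]
  push_cast
  gcongr
  exact Nat.floor_le (by positivity)

theorem le_scale {L₀ : ℕ} (h : 1 ≤ L₀) (k : ℕ) : L₀ ≤ scale L₀ k := by
  induction k with
  | zero => exact le_rfl
  | succ k ih =>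
    refine ih.trans ?_
    have h1 : (1 : ℝ) ≤ scale L₀ k := by exact_mod_cast h.trans ih
    have h2 := (Real.self_le_rpow_of_one_le h1 (by norm_num : (1 : ℝ) ≤ 3 / 2)).trans
      (rpow_le_scale_succ L₀ k)
    exact_mod_cast h2

/-- The double-exponential growth of the scales dominates the growth of the exponents. -/
theorem pow_le_log_scale {L₀ : ℕ} (h : 3 ≤ L₀) {θ : ℝ} (hθ : 0 < θ) (hθ' : θ < 1 / 3) (k : ℕ) :
    (1 + θ) ^ k ≤ Real.log (scale L₀ k) := by
  induction k with
  | zero =>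
    rw [pow_zero, Real.le_log_iff_exp_le (by simp only [scale]; positivity)]
    have h1 : (3 : ℝ) ≤ L₀ := by exact_mod_cast h
    exact (Real.exp_one_lt_d9.le.trans (by norm_num)).trans h1
  | succ k ih =>
    have hpos : (0 : ℝ) < scale L₀ k := by
      exact_mod_cast (show 0 < L₀ by omega).trans_le (le_scale (by omega) k)
    have h1 : 3 / 2 * Real.log (scale L₀ k) ≤ Real.log (scale L₀ (k + 1)) := by
      rw [← Real.log_rpow hpos]
      exact Real.log_le_log (by positivity) (rpow_le_scale_succ L₀ k)
    refine le_trans ?_ h1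
    have h2 : 0 < (1 + θ) ^ k := by positivity
    rw [pow_succ]
    nlinarith

end Scales

end MultiParticleAnderson

/-! ### The induction step -/

theorem mainTheorem5
    (N d : ℕ) (hN : 2 ≤ N) (hd : 1 ≤ d)
    (Φ : ℕ → ℝ) (r₀ : ℕ) (hΦ : Function.support Φ ⊆ Set.Icc 0 r₀)
    (μ : Measure ℝ) (M : ℝ) (hμ : IsAdmissibleLaw μ M)
    (θ p m : ℝ) (hθ : 0 < θ) (hθ' : θ < 1 / 3)
    (hp : 6 * N * d / (1 - 3 * θ) < p)
    (hm : 0 < m) (hm' : m ≤ 1 / (2 ^ (N + 1) * (12 * N * d))) :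
    ∃ Lstar : ℕ, ∀ L₀ : ℕ, Lstar ≤ L₀ →
      ∀ (Ω : Type*) [MeasurableSpace Ω] (P : Measure Ω) [IsProbabilityMeasure P]
        (V : Site d → Ω → ℝ), IsIIDField P V μ →
      ∀ (h : ℝ) (n : ℕ), 1 ≤ n → n ≤ N → ∀ k : ℕ,
        (∀ n' : ℕ, 1 ≤ n' → n' < n → SingularityBound P V N Φ M h m p θ L₀ n' k) →
        SingularityBound P V N Φ M h m p θ L₀ n k →
        SingularityBound P V N Φ M h m p θ L₀ n (k + 1) := by
  have hN1 : 1 ≤ N := by omega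
  obtain ⟨C, hC, hCμ⟩ := hμ.exists_le_volume
  have hp0 : 0 < p := by
    have : 0 < 1 - 3 * θ := by linarith
    exact lt_of_le_of_lt (by positivity) hp
  have hdec : ∀ᶠ L : ℕ in Filter.atTop, ∀ n ∈ Finset.Icc 1 N, ∀ L' : ℕ,
      (L : ℝ) ^ (3 / 2 : ℝ) ≤ L' → ∀ t : ℕ,
      L' ≤ t * (L + 1) + 2 * (8 * N * L + 1) + 2 * (L + 1) →
      (griConst n d (8 * N * L) * (Real.exp (-√L))⁻¹ *
        (griConst n d L * Real.exp (-(decayRate N m L n * L)))) ^ t * (Real.exp (-√L))⁻¹ ≤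
        Real.exp (-(decayRate N m L' n * L')) := by
    rw [Finset.eventually_all]
    intro n hn
    rw [Finset.mem_Icc] at hn
    exact eventually_decay hN1 hn.1 hn.2 hd hm
  -- `8N ≤ √L` makes the radius `8NL` of the clusters at most `L ^ (3/2) ≤ L'`
  obtain ⟨L₁, hL₁⟩ := Filter.eventually_atTop.1 (hdec.and
    ((eventually_probability_le hN1 hd hθ hθ' hp hC).and
      (tendsto_sqrt_natCast.eventually_ge_atTop (8 * N))))
  refine ⟨max L₁ (max 3 r₀), fun L₀ hL₀ Ω _ P _ V hV h n hn1 hn k hlower hsame E hE u => ?_⟩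
  have hL0 : 3 ≤ L₀ := by omega
  set L := scale L₀ k with hLdef
  set L' := scale L₀ (k + 1) with hL'def
  have hL₀L : L₀ ≤ L := le_scale (by omega) k
  have hLL' : (L : ℝ) ^ (3 / 2 : ℝ) ≤ L' := rpow_le_scale_succ L₀ k
  obtain ⟨hdecay, hprob, hsqrt⟩ := hL₁ L (by omega)
  have hx1 : (1 : ℝ) ≤ L := by exact_mod_cast (show 1 ≤ L by omega)
  set b : ℝ := 2 * p * 4 ^ (N - n) * (1 + θ) ^ k with hb
  have h4 : (1 : ℝ) ≤ 4 ^ (N - n) := one_le_pow₀ (by norm_num)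
  have hk : (1 : ℝ) ≤ (1 + θ) ^ k := one_le_pow₀ (by linarith)
  have hb1 : 2 * p ≤ b := by
    rw [hb, mul_assoc]
    exact le_mul_of_one_le_right (by positivity) (one_le_mul_of_one_le_of_one_le h4 hk)
  have hb2 : b ≤ 2 * p * 4 ^ N * Real.log L := by
    rw [hb]
    gcongr
    · norm_num
    · omega
    · exact pow_le_log_scale hL0 hθ hθ' k
  have hA : 2 * L + 2 * (n * (2 * L + r₀)) ≤ 8 * N * L := by
    have h1 : n * (2 * L + r₀) ≤ N * (3 * L) := Nat.mul_le_mul hn (by omega)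
    nlinarith
  have hA' : 8 * N * L ≤ L' := by
    have h1 : (8 * N * L : ℝ) ≤ (L : ℝ) ^ (3 / 2 : ℝ) := by
      have e : (L : ℝ) ^ (3 / 2 : ℝ) = √L * L := by
        rw [show (3 / 2 : ℝ) = 1 / 2 + 1 by norm_num, Real.rpow_add (by linarith),
          Real.rpow_one, Real.sqrt_eq_rpow]
      rw [e]
      gcongr
    exact_mod_cast h1.trans hLL'
  have hq' : ∀ n', 1 ≤ n' → n' < n → ∀ E ∈ energyInterval N d Φ M h, ∀ u' : Config n' d,
      P.real {ω | IsSingular N Φ (fun s => V s ω) E m h u' L} ≤ (L : ℝ) ^ (-(4 * b)) := by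
    intro n' hn' hn'n E hE u'
    refine (hlower n' hn' hn'n E hE u').trans (Real.rpow_le_rpow_of_exponent_le hx1 ?_)
    rw [neg_le_neg_iff]
    have h1 : (4 : ℝ) * 4 ^ (N - n) ≤ 4 ^ (N - n') := by
      rw [← pow_succ']
      exact pow_le_pow_right₀ (by norm_num) (by omega)
    calc 4 * b = 2 * p * (4 * 4 ^ (N - n)) * (1 + θ) ^ k := by rw [hb]; ring
      _ ≤ 2 * p * 4 ^ (N - n') * (1 + θ) ^ k := by gcongr
  have hstep := measureReal_singular_step_le hV hμ hC hCμ hd hΦ hm.le hm' hn1 hn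
    (L := L) (L' := L') (A := 8 * N * L) (by omega) hA hA' (Real.exp_pos (-√L))
    (Real.exp_le_one_iff.2 (by simp)) (hdecay n (Finset.mem_Icc.2 ⟨hn1, hn⟩) L' hLL')
    (by positivity) hq' (hsame E hE) u (D := ((2 * L' + 1 : ℕ) : ℝ) ^ (N * d))
    (pow_le_pow_right₀ (by exact_mod_cast (show 1 ≤ 2 * L' + 1 by omega))
      (Nat.mul_le_mul_right d hn))
  refine hstep.trans ((hprob L' (by omega) (scale_succ_le L₀ k) b hb1 hb2).trans (le_of_eq ?_))
  congr 1
  rw [hb, pow_succ]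
  ring
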